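/- We work in many-sorted first-order logic with equality over countable, effectively given signatures (membership of sorts and symbols is decidable); all structures have nonempty domains. A theory over a signature $\Sigma$ is a set of $\Sigma$-sentences; it is consistent if it has a model. A quantifier-free formula is $T$-satisfiable if it is true in some model of $T$ under some valuation of its free variables. Let $\Sigma_{sub}$ consist of one sort $S$ and finitely many distinct constants $\underline c = c_1,\dots,c_n$ ($n\ge 1$) of sort $S$, and let $T_{sub}$ be the enumerated data-type theory $\{\bigwedge_{i\ne j} c_i\neq c_j,\ \forall x{:}S.\ \bigvee_i x=c_i\}$. Let $\Sigma_{WF}$ and $\Sigma_{PM}$ be signatures with $\Sigma_{WF}\cap\Sigma_{PM}=\Sigma_{sub}$, let $\underline p$ be a set of predicate symbols over sorts of $\Sigma_{PM}$ that do not occur in $\Sigma_{WF}\cup\Sigma_{PM}$, and write $\Sigma_1=\Sigma_{WF}$, $\Sigma_2=\Sigma_{PM}\cup\underline p$. Let $T_{WF}\supseteq T_{sub}$ and $T_{PM}\supseteq T_{sub}$ be consistent theories over $\Sigma_1$ and $\Sigma_2$. Let $T_{WF}\text{-sat}$ and $T_{PM}\text{-sat}$ be decision procedures for the corresponding satisfiability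 problems: computable functions that map each finite conjunction $\Gamma$ of $\Sigma_i$-literals to "sat" only if $\Gamma$ is satisfiable in the theory, and otherwise to "unsat" together with a conflict set $\pi$, a conjunction of literals of $\Gamma$ that is unsatisfiable in the theory. Put $T_{SOA}=T_{WF}\cup T_{PM}$. Consider the following algorithm $T_{SOA}\text{-sat}$, whose input is a quantifier-free formula $\varphi$ over $\Sigma_1\cup\Sigma_2$. 1. Purify $\varphi$ into $\phi$: name subterms whose head symbol is alien to the signature in which they occur by fresh constants, and add the defining equations of these constants, so that each atom of $\phi$ is over $\Sigma_1$ or over $\Sigma_2$. Let $\underline a$ be the set of the fresh constants and of the free variables of $\varphi$ of sort $S$ (free variables are treated as constants). 2. Let $A$ be the set of the atoms of $\phi$ and of all equations $a=c$ with $a\in\underline a$, $c\in\underline c$. 3. While $\phi$ is satisfiable with its atoms seen as Boolean variables: pick any total truth assignment on $A$ that makes $\phi$ true. Let $\Gamma_{WF}$ and $\Gamma_{PM}$ be the conjunctions of the resulting literals over those atoms of the initial $\phi$ that are over $\Sigma_1$ and over $\Sigma_2$, respectively, and let the arrangement $\Delta_{sub}$ be the conjunction of those over the equations $a=c$. Run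 $T_{WF}\text{-sat}(\Gamma_{WF}\wedge\Delta_{sub})$ and $T_{PM}\text{-sat}(\Gamma_{PM}\wedge\Delta_{sub})$. If both answers are "sat", return "sat". Otherwise, for each answer "unsat" with conflict set $\pi$, replace $\phi$ with $\phi\wedge\neg\pi$. 4. If the loop ends, return "unsat". Then $T_{SOA}\text{-sat}$ is a decision procedure for $T_{SOA}$-satisfiability: on every quantifier-free $(\Sigma_1\cup\Sigma_2)$-formula $\varphi$, whatever assignments are picked, every run terminates and returns an answer; the answer is "sat" if and only if $\varphi$ is $T_{SOA}$-satisfiable; and the answer is a computable function of $\varphi$. -/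

import Mathlib

namespace SOA

/-! Many-sorted first-order logic with equality. Symbols carry their rank, so that every countable
many-sorted signature is a set of sorts and symbols taken from the universal language below. -/

/-- A variable: a name and a sort. -/
abbrev Var := ℕ × ℕ

/-- A function symbol: a name, the list of argument sorts, the result sort. -/
abbrev FunSym := ℕ × List ℕ × ℕ

/-- A predicate symbol: a name and the list of argument sorts. -/
abbrev RelSym := ℕ × List ℕ

abbrev Var.name (x : Var) : ℕ := x.1
abbrev Var.sort (x : Var) : ℕ := x.2
abbrev FunSym.dom (f : FunSym) : List ℕ := f.2.1
abbrev FunSym.cod (f : FunSym) : ℕ := f.2.2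
abbrev RelSym.dom (r : RelSym) : List ℕ := r.2

/-- Well-sorted terms, indexed by their sort. -/
inductive Term : ℕ → Type
  | var (x : Var) : Term (Var.sort x)
  | app (f : FunSym) (ts : ∀ i : Fin (FunSym.dom f).length, Term ((FunSym.dom f).get i)) :
      Term (FunSym.cod f)

/-- The constant symbol of sort `s` with name `c`. -/
abbrev constSym (s c : ℕ) : FunSym := (c, [], s)

/-- The term consisting of a constant symbol. -/
def Term.const (s c : ℕ) : Term s := Term.app (constSym s c) (fun i => i.elim0)

/-- Atoms: equations between terms of the same sort, and predicates applied to terms. -/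
inductive Atom : Type
  | equal {s : ℕ} (t u : Term s) : Atom
  | rel (r : RelSym) (ts : ∀ i : Fin (RelSym.dom r).length, Term ((RelSym.dom r).get i)) : Atom

/-- A literal: an atom with its sign (`true` for the atom, `false` for its negation). -/
abbrev Literal := Atom × Bool

/-- First-order formulae. -/
inductive Formula : Type
  | tru : Formula
  | atom (α : Atom) : Formula
  | not (φ : Formula) : Formula
  | and (φ ψ : Formula) : Formula
  | or (φ ψ : Formula) : Formula
  | all (x : Var) (φ : Formula) : Formula
  | ex (x : Var) (φ : Formula) : Formula

/-- Quantifier-free formulae. -/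
inductive QF : Type
  | tru : QF
  | atom (α : Atom) : QF
  | not (φ : QF) : QF
  | and (φ ψ : QF) : QF
  | or (φ ψ : QF) : QF

/-! Variables of an expression. -/

def Term.vars {s : ℕ} : Term s → List Var
  | .var x => [x]
  | .app _ ts => (List.ofFn fun i => (ts i).vars).flatten

def Atom.vars : Atom → List Var
  | .equal t u => t.vars ++ u.vars
  | .rel _ ts => (List.ofFn fun i => (ts i).vars).flatten

def QF.vars : QF → List Var
  | .tru => []
  | .atom α => α.vars
  | .not φ => φ.vars
  | .and φ ψ => φ.vars ++ ψ.vars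
  | .or φ ψ => φ.vars ++ ψ.vars

/-- The variables that occur free in a formula. -/
def Formula.free : Formula → Set Var
  | .tru => ∅
  | .atom α => {x | x ∈ α.vars}
  | .not φ => φ.free
  | .and φ ψ => φ.free ∪ ψ.free
  | .or φ ψ => φ.free ∪ ψ.free
  | .all x φ => φ.free \ {x}
  | .ex x φ => φ.free \ {x}

/-! Signatures. -/

/-- A many-sorted signature. -/
@[ext]
structure Signature where
  sorts : Set ℕ
  funs : Set FunSym
  rels : Set RelSym
  dom_mem : ∀ f ∈ funs, ∀ s ∈ FunSym.dom f, s ∈ sorts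
  cod_mem : ∀ f ∈ funs, FunSym.cod f ∈ sorts
  rel_mem : ∀ r ∈ rels, ∀ s ∈ RelSym.dom r, s ∈ sorts

/-- The union of two signatures. -/
def Signature.union (A B : Signature) : Signature where
  sorts := A.sorts ∪ B.sorts
  funs := A.funs ∪ B.funs
  rels := A.rels ∪ B.rels
  dom_mem := fun f hf s hs =>
    hf.elim (fun h => Or.inl (A.dom_mem f h s hs)) (fun h => Or.inr (B.dom_mem f h s hs))
  cod_mem := fun f hf =>
    hf.elim (fun h => Or.inl (A.cod_mem f h)) (fun h => Or.inr (B.cod_mem f h))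
  rel_mem := fun r hr s hs =>
    hr.elim (fun h => Or.inl (A.rel_mem r h s hs)) (fun h => Or.inr (B.rel_mem r h s hs))

/-- The intersection of two signatures. -/
def Signature.inter (A B : Signature) : Signature where
  sorts := A.sorts ∩ B.sorts
  funs := A.funs ∩ B.funs
  rels := A.rels ∩ B.rels
  dom_mem := fun f hf s hs => ⟨A.dom_mem f hf.1 s hs, B.dom_mem f hf.2 s hs⟩
  cod_mem := fun f hf => ⟨A.cod_mem f hf.1, B.cod_mem f hf.2⟩
  rel_mem := fun r hr s hs => ⟨A.rel_mem r hr.1 s hs, B.rel_mem r hr.2 s hs⟩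

/-- The signature `A` with the predicate symbols in `P`, over sorts of `A`, added to it. -/
def Signature.withPreds (A : Signature) (P : Set RelSym)
    (hP : ∀ r ∈ P, ∀ s ∈ RelSym.dom r, s ∈ A.sorts) : Signature where
  sorts := A.sorts
  funs := A.funs
  rels := A.rels ∪ P
  dom_mem := A.dom_mem
  cod_mem := A.cod_mem
  rel_mem := fun r hr s hs => hr.elim (fun h => A.rel_mem r h s hs) (fun h => hP r h s hs)

/-- The signature with the one sort `S`, the constants named in `C`, and nothing else. -/
def edtSignature (S : ℕ) (C : List ℕ) : Signature where
  sorts := {S}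
  funs := {f | ∃ c ∈ C, f = constSym S c}
  rels := ∅
  dom_mem := by
    rintro f ⟨c, -, rfl⟩ s hs
    simp [FunSym.dom] at hs
  cod_mem := by
    rintro f ⟨c, -, rfl⟩
    rfl
  rel_mem := fun r hr => hr.elim

/-- The signature is effectively given: membership of sorts and symbols is decidable. -/
def Signature.Effective (A : Signature) : Prop :=
  ComputablePred (fun s : ℕ => s ∈ A.sorts) ∧
  ComputablePred (fun f : FunSym => f ∈ A.funs) ∧
  ComputablePred (fun r : RelSym => r ∈ A.rels)

/-- `t` is a term over the signature `A` (with free variables of sorts of `A`). -/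
def Term.In (A : Signature) {s : ℕ} : Term s → Prop
  | .var x => x.2 ∈ A.sorts
  | .app f ts => f ∈ A.funs ∧ ∀ i, (ts i).In A

def Atom.In (A : Signature) : Atom → Prop
  | .equal t u => t.In A ∧ u.In A
  | .rel r ts => r ∈ A.rels ∧ ∀ i, (ts i).In A

def Formula.In (A : Signature) : Formula → Prop
  | .tru => True
  | .atom α => α.In A
  | .not φ => φ.In A
  | .and φ ψ => φ.In A ∧ ψ.In A
  | .or φ ψ => φ.In A ∧ ψ.In A
  | .all x φ => x.2 ∈ A.sorts ∧ φ.In A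
  | .ex x φ => x.2 ∈ A.sorts ∧ φ.In A

def QF.In (A : Signature) : QF → Prop
  | .tru => True
  | .atom α => α.In A
  | .not φ => φ.In A
  | .and φ ψ => φ.In A ∧ ψ.In A
  | .or φ ψ => φ.In A ∧ ψ.In A

/-! Semantics. -/

/-- A structure with nonempty domains. It interprets all sorts and symbols of the universal
language; the truth of formulae over a signature `A` depends only on its `A`-reduct, and every
`A`-structure with nonempty domains is the `A`-reduct of some such structure. In particular fresh
predicate symbols (relational state variables) get their value from the structure. -/
structure Struc where
  carrier : ℕ → Type
  nonempty : ∀ s, Nonempty (carrier s)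
  fn : ∀ f : FunSym, (∀ i : Fin (FunSym.dom f).length, carrier ((FunSym.dom f).get i)) →
    carrier (FunSym.cod f)
  rel : ∀ r : RelSym, (∀ i : Fin (RelSym.dom r).length, carrier ((RelSym.dom r).get i)) → Prop

/-- A valuation of the variables. -/
abbrev Struc.Val (M : Struc) := ∀ x : Var, M.carrier (Var.sort x)

def Term.eval (M : Struc) (v : M.Val) {s : ℕ} : Term s → M.carrier s
  | .var x => v x
  | .app f ts => M.fn f (fun i => (ts i).eval M v)

def Atom.Holds (M : Struc) (v : M.Val) : Atom → Prop
  | .equal t u => t.eval M v = u.eval M v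
  | .rel r ts => M.rel r (fun i => (ts i).eval M v)

def Formula.Holds (M : Struc) : Formula → M.Val → Prop
  | .tru, _ => True
  | .atom α, v => α.Holds M v
  | .not φ, v => ¬ φ.Holds M v
  | .and φ ψ, v => φ.Holds M v ∧ ψ.Holds M v
  | .or φ ψ, v => φ.Holds M v ∨ ψ.Holds M v
  | .all x φ, v => ∀ d : M.carrier (Var.sort x), φ.Holds M (Function.update v x d)
  | .ex x φ, v => ∃ d : M.carrier (Var.sort x), φ.Holds M (Function.update v x d)

def QF.Holds (M : Struc) (v : M.Val) : QF → Prop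
  | .tru => True
  | .atom α => α.Holds M v
  | .not φ => ¬ φ.Holds M v
  | .and φ ψ => φ.Holds M v ∧ ψ.Holds M v
  | .or φ ψ => φ.Holds M v ∨ ψ.Holds M v

def Literal.Holds (M : Struc) (v : M.Val) (l : Literal) : Prop :=
  if l.2 then l.1.Holds M v else ¬ l.1.Holds M v

/-- A theory over the signature `A`: a set of sentences over `A`. -/
def IsTheory (A : Signature) (T : Set Formula) : Prop :=
  ∀ φ ∈ T, φ.In A ∧ φ.free = ∅

/-- `M` is a model of `T`. -/
def Struc.Models (M : Struc) (T : Set Formula) : Prop :=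
  ∀ φ ∈ T, ∀ v : M.Val, φ.Holds M v

def Consistent (T : Set Formula) : Prop := ∃ M : Struc, M.Models T

/-- The quantifier-free formula `φ` is `T`-satisfiable. -/
def SatQF (T : Set Formula) (φ : QF) : Prop :=
  ∃ M : Struc, M.Models T ∧ ∃ v : M.Val, φ.Holds M v

/-- The conjunction of the literals in `Γ` is `T`-satisfiable. -/
def SatLits (T : Set Formula) (Γ : List Literal) : Prop :=
  ∃ M : Struc, M.Models T ∧ ∃ v : M.Val, ∀ l ∈ Γ, Literal.Holds M v l

/-! Enumerated data-type theories. -/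

def Formula.conj : List Formula → Formula
  | [] => .tru
  | φ :: l => .and φ (Formula.conj l)

def Formula.disj : List Formula → Formula
  | [] => .not .tru
  | φ :: l => .or φ (Formula.disj l)

/-- The constants in `C` are pairwise distinct. -/
def edtDistinct (S : ℕ) (C : List ℕ) : Formula :=
  .conj (((C ×ˢ C).filter (fun p => p.1 ≠ p.2)).map
    (fun p => .not (.atom (.equal (Term.const S p.1) (Term.const S p.2)))))

/-- Every element of sort `S` is the value of one of the constants in `C`. -/
def edtCovers (S : ℕ) (C : List ℕ) : Formula :=
  .all (0, S) (.disj (C.map (fun c => .atom (.equal (Term.var (0, S)) (Term.const S c)))))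

/-- The enumerated data-type theory on the sort `S` with the constants named in `C`. -/
def EDT (S : ℕ) (C : List ℕ) : Set Formula := {edtDistinct S C, edtCovers S C}

/-! Expressions as words (postfix notation), so that computability is that of functions on words
over a countable alphabet. -/

/-- The alphabet: variables, function symbols, predicate symbols, and logical symbols given by
numbers. -/
abbrev Token := Var ⊕ FunSym ⊕ RelSym ⊕ ℕ

abbrev Token.var (x : Var) : Token := Sum.inl x
abbrev Token.fn (f : FunSym) : Token := Sum.inr (Sum.inl f)
abbrev Token.rel (r : RelSym) : Token := Sum.inr (Sum.inr (Sum.inl r))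
abbrev Token.logic (n : ℕ) : Token := Sum.inr (Sum.inr (Sum.inr n))

def Term.code {s : ℕ} : Term s → List Token
  | .var x => [Token.var x]
  | .app f ts => (List.ofFn fun i => (ts i).code).flatten ++ [Token.fn f]

def Atom.code : Atom → List Token
  | .equal t u => t.code ++ u.code ++ [Token.logic 0]
  | .rel r ts => (List.ofFn fun i => (ts i).code).flatten ++ [Token.rel r]

def QF.code : QF → List Token
  | .tru => [Token.logic 1]
  | .atom α => α.code
  | .not φ => φ.code ++ [Token.logic 2]
  | .and φ ψ => φ.code ++ ψ.code ++ [Token.logic 3]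
  | .or φ ψ => φ.code ++ ψ.code ++ [Token.logic 4]

def Literal.code (l : Literal) : List Token × Bool := (l.1.code, l.2)

/-! Theory solvers. -/

/-- A theory solver maps a finite conjunction of literals either to `none`, meaning "sat", or to
`some π`, meaning "unsat" with conflict set `π`. -/
abbrev Solver := List Literal → Option (List Literal)

/-- `solve` is a decision procedure for the `T`-satisfiability of finite conjunctions of literals
over `A`: it is an algorithm, its answers are correct, and a conflict set consists of literals of
the input and is `T`-unsatisfiable. -/
structure Solver.Decides (solve : Solver) (A : Signature) (T : Set Formula) : Prop where
  sat : ∀ Γ : List Literal, (∀ l ∈ Γ, l.1.In A) → solve Γ = none → SatLits T Γ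
  unsat : ∀ Γ π : List Literal, (∀ l ∈ Γ, l.1.In A) → solve Γ = some π →
    (∀ l ∈ π, l ∈ Γ) ∧ ¬ SatLits T π
  computable : ∃ g : List (List Token × Bool) → Option (List (List Token × Bool)),
    Computable g ∧ ∀ Γ : List Literal, (∀ l ∈ Γ, l.1.In A) →
      g (Γ.map Literal.code) = (solve Γ).map (List.map Literal.code)

/-! Purification. -/

/-- The two levels. -/
inductive Side : Type
  | wf
  | pm

def Side.other : Side → Side
  | .wf => .pm
  | .pm => .wf

/-- The two signatures, as a family indexed by the level. -/
def levels (A B : Signature) : Side → Signature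
  | .wf => A
  | .pm => B

/-- A subterm to be named, with the side that its head symbol belongs to. -/
abbrev Alien := Side × (s : ℕ) × Term s

def Alien.term (p : Alien) : Term p.2.1 := p.2.2

open Classical in
/-- The maximal subterms of `t` whose head symbol is alien to the side `L`, the maximal proper
subterms of these that are alien to the other side, and so on. -/
noncomputable def Term.aliens (sig : Side → Signature) {s : ℕ} : Term s → Side → List Alien
  | .var _, _ => []
  | .app f ts, L =>
      if f ∈ (sig L).funs then (List.ofFn fun i => (ts i).aliens sig L).flatten
      else (L.other, ⟨FunSym.cod f, .app f ts⟩) ::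
        (List.ofFn fun i => (ts i).aliens sig L.other).flatten

open Classical in
/-- The term `t` with each maximal subterm `u` that is alien to the side `L` replaced with the
constant that names `u` (see `purifyName`). -/
noncomputable def Term.pure (sig : Side → Signature) (name : List Token → ℕ) (L : Side) {s : ℕ} :
    Term s → Term s
  | .var x => .var x
  | .app f ts =>
      if f ∈ (sig L).funs then .app f (fun i => (ts i).pure sig name L)
      else .var (name (Term.app f ts).code, FunSym.cod f)

open Classical in
/-- The side on which an atom is purified, chosen so that an atom that is already pure is left
unchanged. -/
noncomputable def Atom.side (sig : Side → Signature) : Atom → Side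
  | .equal (s := s) t u =>
      if s ∈ (sig .wf).sorts ∧ ¬ (t.In (sig .pm) ∧ u.In (sig .pm)) then .wf else .pm
  | .rel r _ => if r ∈ (sig .wf).rels then .wf else .pm

noncomputable def Atom.aliens (sig : Side → Signature) (α : Atom) : List Alien :=
  match α with
  | .equal t u => t.aliens sig (α.side sig) ++ u.aliens sig (α.side sig)
  | .rel _ ts => (List.ofFn fun i => (ts i).aliens sig (α.side sig)).flatten

noncomputable def Atom.pure (sig : Side → Signature) (name : List Token → ℕ) (α : Atom) : Atom :=
  match α with
  | .equal t u => .equal (t.pure sig name (α.side sig)) (u.pure sig name (α.side sig))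
  | .rel r ts => .rel r (fun i => (ts i).pure sig name (α.side sig))

noncomputable def QF.aliens (sig : Side → Signature) : QF → List Alien
  | .tru => []
  | .atom α => α.aliens sig
  | .not φ => φ.aliens sig
  | .and φ ψ => φ.aliens sig ++ ψ.aliens sig
  | .or φ ψ => φ.aliens sig ++ ψ.aliens sig

noncomputable def QF.pure (sig : Side → Signature) (name : List Token → ℕ) : QF → QF
  | .tru => .tru
  | .atom α => .atom (α.pure sig name)
  | .not φ => .not (φ.pure sig name)
  | .and φ ψ => .and (φ.pure sig name) (ψ.pure sig name)
  | .or φ ψ => .or (φ.pure sig name) (ψ.pure sig name)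

/-- The names of the fresh constants: the `i`-th alien subterm of `φ` gets the number `m + i`, where
`m` exceeds the names of all variables of `φ`; equal subterms get the same number. (Free constants
and free variables play the same role in satisfiability problems, so the fresh constants are fresh
variables.) -/
noncomputable def purifyName (sig : Side → Signature) (φ : QF) (w : List Token) : ℕ :=
  (φ.vars.map Var.name).foldr max 0 + 1 + ((φ.aliens sig).map (fun p => p.term.code)).idxOf w

/-- The defining equation `a = u'` of the constant `a` that names the alien subterm `u`, where `u'`
is `u` with its own proper alien subterms replaced with their names. -/
noncomputable def Alien.definition (sig : Side → Signature) (name : List Token → ℕ) (p : Alien) :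
    Atom :=
  .equal (.var (name p.term.code, p.2.1)) (p.term.pure sig name p.1)

def QF.conj : List QF → QF
  | [] => .tru
  | φ :: l => .and φ (QF.conj l)

/-- The purified formula: `φ` with alien subterms replaced with their names, together with the
defining equations of the names. -/
noncomputable def purify (sig : Side → Signature) (φ : QF) : QF :=
  .and (φ.pure sig (purifyName sig φ))
    (.conj ((φ.aliens sig).map (fun p => .atom (p.definition sig (purifyName sig φ)))))

/-- The constants that both levels may share in the purified formula: the fresh constants of
`purify` and the free variables of `φ`, as far as they are of the substrate sort `S`. (Fresh
constants always are, since an alien subterm stands in a place where both levels meet.) -/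
noncomputable def sharedConsts (sig : Side → Signature) (S : ℕ) (φ : QF) : List Var :=
  ((purify sig φ).vars.filter (fun x => x.2 = S)).dedup

/-! The algorithm. -/

def QF.atoms : QF → List Atom
  | .tru => []
  | .atom α => [α]
  | .not φ => φ.atoms
  | .and φ ψ => φ.atoms ++ ψ.atoms
  | .or φ ψ => φ.atoms ++ ψ.atoms

/-- The truth value of `φ` when its atoms are seen as Boolean variables, with values given by
`σ`. -/
def QF.boolEval (σ : Atom → Bool) : QF → Bool
  | .tru => true
  | .atom α => σ α
  | .not φ => !(φ.boolEval σ)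
  | .and φ ψ => φ.boolEval σ && ψ.boolEval σ
  | .or φ ψ => φ.boolEval σ || ψ.boolEval σ

/-- `φ` is satisfiable when its atoms are seen as Boolean variables. -/
def BoolSat (φ : QF) : Prop := ∃ σ : Atom → Bool, φ.boolEval σ = true

/-- All equations between a variable in `as` and a constant, of sort `S`, named in `C`. -/
def interfaceEqs (S : ℕ) (C : List ℕ) (as : List Var) : List Atom :=
  (as ×ˢ C).map (fun p => .equal (Term.var (p.1.1, S)) (Term.const S p.2))

/-- The literals over the atoms in `A` that the assignment `σ` makes true. -/
def litsOf (σ : Atom → Bool) (A : List Atom) : List Literal := A.map (fun α => (α, σ α))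

open Classical in
/-- The input of the theory solver of side `L` for the assignment `σ`: the literals over those
atoms of the purified formula that are over the signature of side `L`, and the arrangement, that is
the literals over all equations between shared constants and substrate constants. -/
noncomputable def query (sig : Side → Signature) (S : ℕ) (C : List ℕ) (φ₀ : QF) (σ : Atom → Bool)
    (L : Side) : List Literal :=
  litsOf σ ((purify sig φ₀).atoms.filter (fun α => α.In (sig L))) ++
    litsOf σ (interfaceEqs S C (sharedConsts sig S φ₀))

def Literal.toQF (l : Literal) : QF := if l.2 then .atom l.1 else .not (.atom l.1)

/-- Add the conflict clause to `φ` if the answer of the solver is "unsat". -/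
def learn (φ : QF) : Option (List Literal) → QF
  | none => φ
  | some π => .and φ (.not (.conj (π.map Literal.toQF)))

/-- The states of the algorithm: at the head of the loop, with the current formula, or after
returning the answer (`true` for "sat", `false` for "unsat"). -/
inductive Config : Type
  | loop (φ : QF)
  | ret (answer : Bool)

/-- The algorithm on input `φ₀`: it starts with the purified formula. -/
noncomputable def start (sig : Side → Signature) (φ₀ : QF) : Config := .loop (purify sig φ₀)

/-- One pass through the loop on input `φ₀`. In the rules `sat` and `conflict` the assignment `σ`
picked is any total assignment that makes the current formula true. -/
inductive Step (sig : Side → Signature) (S : ℕ) (C : List ℕ) (solve : Side → Solver) (φ₀ : QF) :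
    Config → Config → Prop
  | unsat (φ : QF) (h : ¬ BoolSat φ) : Step sig S C solve φ₀ (.loop φ) (.ret false)
  | sat (φ : QF) (σ : Atom → Bool) (h : φ.boolEval σ = true)
      (hs : ∀ L, solve L (query sig S C φ₀ σ L) = none) :
      Step sig S C solve φ₀ (.loop φ) (.ret true)
  | conflict (φ : QF) (σ : Atom → Bool) (h : φ.boolEval σ = true)
      (hs : ¬ ∀ L, solve L (query sig S C φ₀ σ L) = none) :
      Step sig S C solve φ₀ (.loop φ)
        (.loop (learn (learn φ (solve .wf (query sig S C φ₀ σ .wf)))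
          (solve .pm (query sig S C φ₀ σ .pm))))

/-- `d` is reachable from `c` in finitely many steps. -/
abbrev Reaches (sig : Side → Signature) (S : ℕ) (C : List ℕ) (solve : Side → Solver) (φ₀ : QF) :
    Config → Config → Prop :=
  Relation.ReflTransGen (Step sig S C solve φ₀)

/-- The two theory solvers, as a family indexed by the level. -/
def solvers (a b : Solver) : Side → Solver
  | .wf => a
  | .pm => b

/-- The algorithm is a decision procedure for the `T`-satisfiability of quantifier-free formulae
over `A`. -/
structure AlgorithmDecides (sig : Side → Signature) (S : ℕ) (C : List ℕ) (solve : Side → Solver)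
    (A : Signature) (T : Set Formula) : Prop where
  /-- There is no infinite run. -/
  terminates : ∀ φ : QF, φ.In A →
    Acc (fun d c => Step sig S C solve φ c d) (start sig φ)
  /-- A run does not get stuck before an answer is returned. -/
  progress : ∀ φ : QF, φ.In A → ∀ c, Reaches sig S C solve φ (start sig φ) c →
    (∃ d, Step sig S C solve φ c d) ∨ ∃ b, c = .ret b
  /-- The answer of every run is correct. -/
  correct : ∀ φ : QF, φ.In A → ∀ b, Reaches sig S C solve φ (start sig φ) (.ret b) →
    (b = true ↔ SatQF T φ)
  /-- The answer is a computable function of the input. -/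
  computable : ∃ g : List Token → Bool, Computable g ∧ ∀ φ : QF, φ.In A →
    Reaches sig S C solve φ (start sig φ) (.ret (g φ.code))

end SOA

/-! This is a Nelson-Oppen combination in which the shared theory is an enumerated data type. In a
model of `EDT S C` the sort `S` consists of the values of the constants, without repetition, so any
two models have canonically isomorphic substrates. Every other sort belongs to at most one level,
the shared function symbols are just these constants, and no predicate symbol is shared. Hence a
model of each theory can be merged into one model of both, with no cardinality condition
(`exists_merged`). Two valuations merge as well, as soon as each occurring variable of sort `S` is
equated with the same constant on both sides (`exists_combined`).

An arrangement that both solvers accept provides these equations, so the answer "sat" is right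
(`satQF_of_queries`). The answer "unsat" is right because the negation of a conflict set holds in
every model of the theory concerned (`holds_learn`): a model of the purified formula always yields a
Boolean model of the current formula. Purification preserves satisfiability because the defining
equations force the intended values of the names, and the names are free to take them
(`exists_holds_purify_iff`). A run is finite because learned clauses only use atoms of a fixed
finite set and each conflict excludes the assignment that was picked (`acc_loop`).

For computability the loop need not be simulated. By correctness and termination the answer is
determined by satisfiability, so any computable test for the latter will do. The test guesses a
constant for each subterm of sort `S` and a truth value for each atom; the literals expressing the
guesses are pure and arranged, so the solvers can check them (`satQF_iff_exists_out`). On words in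
postfix notation all guesses are enumerated by a primitive recursive stack machine
(`QF.mem_runWord`, `decideWord_code`). -/

namespace SOA

/-! ### Invariance of truth under isomorphism of reducts -/

/-- The value of the constant named `c` of sort `s`. -/
def Struc.const (M : Struc) (s c : ℕ) : M.carrier s := M.fn (constSym s c) (fun i => i.elim0)

theorem Term.eval_const (M : Struc) (v : M.Val) (s c : ℕ) :
    (Term.const s c).eval M v = M.const s c := by
  unfold Term.const Struc.const
  rw [Term.eval]
  congr 1
  funext i
  exact i.elim0

/-- An isomorphism between the `A`-reducts of two structures. -/
structure ReductIso (A : Signature) (M N : Struc) where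
  map : ∀ s, M.carrier s → N.carrier s
  bijective : ∀ s ∈ A.sorts, Function.Bijective (map s)
  fn : ∀ f ∈ A.funs, ∀ args : (∀ i : Fin (FunSym.dom f).length, M.carrier ((FunSym.dom f).get i)),
    map _ (M.fn f args) = N.fn f (fun i => map _ (args i))
  rel : ∀ r ∈ A.rels, ∀ args : (∀ i : Fin (RelSym.dom r).length, M.carrier ((RelSym.dom r).get i)),
    M.rel r args ↔ N.rel r (fun i => map _ (args i))

theorem Term.sort_mem {A : Signature} {s : ℕ} {t : Term s} (h : t.In A) : s ∈ A.sorts := by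
  cases t with
  | var x => simpa [Term.In] using h
  | app f ts =>
    rw [Term.In] at h
    exact A.cod_mem f h.1

theorem Term.mem_vars_app {f : FunSym} {ts : ∀ i : Fin (FunSym.dom f).length,
    Term ((FunSym.dom f).get i)} {x : Var} : x ∈ (Term.app f ts).vars ↔ ∃ i, x ∈ (ts i).vars := by
  rw [Term.vars]
  simp [List.mem_flatten, List.mem_ofFn]

theorem Atom.mem_vars_rel {r : RelSym} {ts : ∀ i : Fin (RelSym.dom r).length,
    Term ((RelSym.dom r).get i)} {x : Var} : x ∈ (Atom.rel r ts).vars ↔ ∃ i, x ∈ (ts i).vars := by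
  rw [Atom.vars]
  simp [List.mem_flatten, List.mem_ofFn]

theorem Term.sort_mem_of_mem_vars {A : Signature} {s : ℕ} {t : Term s} (h : t.In A) {x : Var}
    (hx : x ∈ t.vars) : Var.sort x ∈ A.sorts := by
  induction t with
  | var y =>
    simp only [Term.vars, List.mem_singleton] at hx
    subst hx
    simpa [Term.In] using h
  | app f ts ih =>
    rw [Term.In] at h
    obtain ⟨i, hi⟩ := Term.mem_vars_app.1 hx
    exact ih i (h.2 i) hi

theorem Atom.sort_mem_of_mem_vars {A : Signature} {α : Atom} (h : α.In A) {x : Var}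
    (hx : x ∈ α.vars) : Var.sort x ∈ A.sorts := by
  cases α with
  | equal t u =>
    rw [Atom.vars, List.mem_append] at hx
    exact hx.elim (Term.sort_mem_of_mem_vars h.1) (Term.sort_mem_of_mem_vars h.2)
  | rel r ts =>
    obtain ⟨i, hi⟩ := Atom.mem_vars_rel.1 hx
    exact Term.sort_mem_of_mem_vars (h.2 i) hi

theorem Term.map_eval {A : Signature} {M N : Struc} (E : ReductIso A M N) {v : M.Val} {w : N.Val}
    {s : ℕ} (t : Term s) (ht : t.In A) (hv : ∀ x ∈ t.vars, E.map _ (v x) = w x) :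
    E.map _ (t.eval M v) = t.eval N w := by
  induction t with
  | var x =>
    rw [Term.eval, Term.eval]
    exact hv x (by simp [Term.vars])
  | app f ts ih =>
    rw [Term.In] at ht
    rw [Term.eval, Term.eval, E.fn f ht.1]
    congr 1
    funext i
    exact ih i (ht.2 i) fun x hx => hv x (Term.mem_vars_app.2 ⟨i, hx⟩)

/-- Equations need injectivity on their sort, which is a sort of `A`. Agreement of the valuations is
asked only on the occurring variables, since a merged valuation can match two given ones only there.
-/
theorem Atom.holds_iff {A : Signature} {M N : Struc} (E : ReductIso A M N) {v : M.Val} {w : N.Val}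
    (α : Atom) (hα : α.In A) (hv : ∀ x ∈ α.vars, E.map _ (v x) = w x) :
    α.Holds M v ↔ α.Holds N w := by
  cases α with
  | equal t u =>
    rw [Atom.In] at hα
    simp only [Atom.vars, List.mem_append] at hv
    rw [Atom.Holds, Atom.Holds, ← t.map_eval E hα.1 fun x hx => hv x (Or.inl hx),
      ← u.map_eval E hα.2 fun x hx => hv x (Or.inr hx)]
    exact (E.bijective _ (Term.sort_mem hα.1)).1.eq_iff.symm
  | rel r ts =>
    rw [Atom.In] at hα
    rw [Atom.Holds, Atom.Holds, E.rel r hα.1]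
    have : (fun i => E.map _ ((ts i).eval M v)) = fun i => (ts i).eval N w := by
      funext i
      exact (ts i).map_eval E (hα.2 i) fun x hx => hv x (Atom.mem_vars_rel.2 ⟨i, hx⟩)
    rw [this]

theorem Literal.holds_iff {A : Signature} {M N : Struc} (E : ReductIso A M N) {v : M.Val}
    {w : N.Val} (l : Literal) (hl : l.1.In A) (hv : ∀ x ∈ l.1.vars, E.map _ (v x) = w x) :
    Literal.Holds M v l ↔ Literal.Holds N w l := by
  unfold Literal.Holds
  rw [l.1.holds_iff E hl hv]

theorem ReductIso.map_update {A : Signature} {M N : Struc} (E : ReductIso A M N) (v : M.Val)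
    (x : Var) (d : M.carrier (Var.sort x)) :
    (fun y => E.map _ (Function.update v x d y) : N.Val) =
      Function.update (fun y => E.map _ (v y)) x (E.map _ d) := by
  funext y
  by_cases h : y = x
  · subst h; simp
  · simp [h]

/-- Surjectivity on the sorts of `A` lets a quantifier over the carrier of `N` be replaced with one
over the carrier of `M`. -/
theorem Formula.holds_iff {A : Signature} {M N : Struc} (E : ReductIso A M N) (φ : Formula)
    (hφ : φ.In A) (v : M.Val) : φ.Holds M v ↔ φ.Holds N (fun x => E.map _ (v x)) := by
  induction φ generalizing v with
  | tru => simp [Formula.Holds]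
  | atom α => exact α.holds_iff E hφ fun _ _ => rfl
  | not φ ih => simp only [Formula.Holds, ih hφ]
  | and φ ψ ih ih' => simp only [Formula.Holds, ih hφ.1, ih' hφ.2]
  | or φ ψ ih ih' => simp only [Formula.Holds, ih hφ.1, ih' hφ.2]
  | all x φ ih =>
    simp only [Formula.Holds, ih hφ.2, E.map_update]
    exact (E.bijective _ hφ.1).2.forall
      (p := fun d => φ.Holds N (Function.update (fun y => E.map _ (v y)) x d)) |>.symm
  | ex x φ ih =>
    simp only [Formula.Holds, ih hφ.2, E.map_update]
    exact (E.bijective _ hφ.1).2.exists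
      (p := fun d => φ.Holds N (Function.update (fun y => E.map _ (v y)) x d)) |>.symm

theorem Struc.Models.of_reductIso {A : Signature} {M N : Struc} (E : ReductIso A M N)
    {T : Set Formula} (hT : IsTheory A T) (hN : N.Models T) : M.Models T := fun φ hφ v =>
  (φ.holds_iff E (hT φ hφ).1 v).2 (hN φ hφ _)

theorem Formula.holds_conj {M : Struc} {v : M.Val} {l : List Formula} :
    (Formula.conj l).Holds M v ↔ ∀ φ ∈ l, φ.Holds M v := by
  induction l with
  | nil => simp [Formula.conj, Formula.Holds]
  | cons φ l ih => simp [Formula.conj, Formula.Holds, ih]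

theorem Formula.holds_disj {M : Struc} {v : M.Val} {l : List Formula} :
    (Formula.disj l).Holds M v ↔ ∃ φ ∈ l, φ.Holds M v := by
  induction l with
  | nil => simp [Formula.disj, Formula.Holds]
  | cons φ l ih => simp [Formula.disj, Formula.Holds, ih]

/-! ### Models of enumerated data-type theories -/

theorem Struc.exists_val (M : Struc) : Nonempty M.Val := ⟨fun _ => (M.nonempty _).some⟩

theorem Struc.Models.const_injOn {M : Struc} {S : ℕ} {C : List ℕ} {T : Set Formula}
    (hT : EDT S C ⊆ T) (hM : M.Models T) {c d : ℕ} (hc : c ∈ C) (hd : d ∈ C)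
    (h : M.const S c = M.const S d) : c = d := by
  by_contra hne
  obtain ⟨v⟩ := M.exists_val
  have := hM _ (hT (Or.inl rfl)) v
  rw [edtDistinct, Formula.holds_conj] at this
  have := this (.not (.atom (.equal (Term.const S c) (Term.const S d))))
    (List.mem_map.2 ⟨(c, d), by simp [hc, hd, hne], rfl⟩)
  simp only [Formula.Holds, Atom.Holds, Term.eval_const] at this
  exact this h

theorem Struc.Models.exists_const {M : Struc} {S : ℕ} {C : List ℕ} {T : Set Formula}
    (hT : EDT S C ⊆ T) (hM : M.Models T) (d : M.carrier S) : ∃ c ∈ C, d = M.const S c := by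
  obtain ⟨v⟩ := M.exists_val
  have := hM _ (hT (Or.inr rfl)) v
  rw [edtCovers, Formula.Holds] at this
  have := this d
  rw [Formula.holds_disj] at this
  obtain ⟨φ, hφ, h⟩ := this
  obtain ⟨c, hc, rfl⟩ := List.mem_map.1 hφ
  refine ⟨c, hc, ?_⟩
  simp only [Formula.Holds, Atom.Holds, Term.eval_const] at h
  rw [Term.eval] at h
  simpa using h

/-- The atom `x = c`. -/
abbrev Atom.eqConst (x : Var) (c : ℕ) : Atom := .equal (Term.var x) (Term.const (Var.sort x) c)

theorem Atom.holds_eqConst {M : Struc} {v : M.Val} {x : Var} {c : ℕ} :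
    (Atom.eqConst x c).Holds M v ↔ v x = M.const (Var.sort x) c := by
  rw [Atom.Holds, Term.eval_const, Term.eval]

theorem Term.in_const {A : Signature} {s c : ℕ} (h : constSym s c ∈ A.funs) :
    (Term.const s c).In A := by
  rw [Term.const, Term.In]
  exact ⟨h, fun i => i.elim0⟩

theorem Atom.in_eqConst {A : Signature} {x : Var} {c : ℕ}
    (h : constSym (Var.sort x) c ∈ A.funs) : (Atom.eqConst x c).In A := by
  refine ⟨?_, Term.in_const h⟩
  rw [Term.In]
  exact A.cod_mem _ h

/-! ### Merging models over a shared enumerated sort -/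

section Combination

variable {A₁ A₂ : Signature} {S : ℕ} {C : List ℕ}

theorem sort_eq_of_mem (h : A₁.inter A₂ = edtSignature S C) {s : ℕ} (h₁ : s ∈ A₁.sorts)
    (h₂ : s ∈ A₂.sorts) : s = S := by
  have : s ∈ (A₁.inter A₂).sorts := ⟨h₁, h₂⟩
  rw [h] at this
  exact this

theorem const_mem_both (h : A₁.inter A₂ = edtSignature S C) {c : ℕ} (hc : c ∈ C) :
    constSym S c ∈ A₁.funs ∧ constSym S c ∈ A₂.funs := by
  have : constSym S c ∈ (A₁.inter A₂).funs := by rw [h]; exact ⟨c, hc, rfl⟩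
  exact this

theorem exists_const_of_mem (h : A₁.inter A₂ = edtSignature S C) {f : FunSym} (h₁ : f ∈ A₁.funs)
    (h₂ : f ∈ A₂.funs) : ∃ c ∈ C, f = constSym S c := by
  have : f ∈ (A₁.inter A₂).funs := ⟨h₁, h₂⟩
  rw [h] at this
  exact this

theorem rel_not_mem_both (h : A₁.inter A₂ = edtSignature S C) {r : RelSym} (h₁ : r ∈ A₁.rels) :
    r ∉ A₂.rels := fun h₂ => by
  have : r ∈ (A₁.inter A₂).rels := ⟨h₁, h₂⟩
  rw [h] at this
  exact this

/-- Two models of an enumerated data-type theory have the substrate in common, up to isomorphism,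
so that their domains can be merged. -/
theorem exists_merged_carrier (h : A₁.inter A₂ = edtSignature S C) {T₁ T₂ : Set Formula}
    (hE₁ : EDT S C ⊆ T₁) (hE₂ : EDT S C ⊆ T₂) {M₁ M₂ : Struc} (hM₁ : M₁.Models T₁)
    (hM₂ : M₂.Models T₂) (s : ℕ) :
    ∃ (X : Type) (e₁ : X → M₁.carrier s) (e₂ : X → M₂.carrier s), Nonempty X ∧
      (s ∈ A₁.sorts → Function.Bijective e₁) ∧ (s ∈ A₂.sorts → Function.Bijective e₂) ∧
      (s = S → ∀ c ∈ C, ∃ x, e₁ x = M₁.const s c ∧ e₂ x = M₂.const s c) := by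
  by_cases hs : s = S
  · subst hs
    -- `k` names each element of the substrate of `M₁` by a constant; since the constants are
    -- distinct, `k` inverts their interpretation. The substrate of `M₁` is then the common domain,
    -- and its map to `M₂` preserves names.
    choose k hk hkv using hM₁.exists_const hE₁
    have key : ∀ c ∈ C, k (M₁.const s c) = c := fun c hc =>
      hM₁.const_injOn hE₁ (hk _) hc (hkv _).symm
    refine ⟨M₁.carrier s, id, fun d => M₂.const s (k d), M₁.nonempty s,
      fun _ => Function.bijective_id, fun _ => ⟨fun a b hab => ?_, fun d => ?_⟩,
      fun _ c hc => ⟨M₁.const s c, rfl, by simp only [key c hc]⟩⟩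
    · rw [hkv a, hkv b, hM₂.const_injOn hE₂ (hk a) (hk b) hab]
    · obtain ⟨c, hc, rfl⟩ := hM₂.exists_const hE₂ d
      exact ⟨M₁.const s c, by simp only [key c hc]⟩
  · by_cases h₁ : s ∈ A₁.sorts
    -- Away from `S` only one level owns the sort, so the map to the other structure is
    -- unconstrained and may be constant.
    · exact ⟨M₁.carrier s, id, fun _ => (M₂.nonempty s).some, M₁.nonempty s,
        fun _ => Function.bijective_id, fun h₂ => absurd (sort_eq_of_mem h h₁ h₂) hs,
        fun h' => absurd h' hs⟩
    · exact ⟨M₂.carrier s, fun _ => (M₁.nonempty s).some, id, M₂.nonempty s,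
        fun h' => absurd h' h₁, fun _ => Function.bijective_id, fun h' => absurd h' hs⟩

/-- Models of two theories that share an enumerated data-type theory can be merged. -/
theorem exists_merged (h : A₁.inter A₂ = edtSignature S C) {T₁ T₂ : Set Formula}
    (hE₁ : EDT S C ⊆ T₁) (hE₂ : EDT S C ⊆ T₂) {M₁ M₂ : Struc} (hM₁ : M₁.Models T₁)
    (hM₂ : M₂.Models T₂) :
    ∃ (M : Struc) (E₁ : ReductIso A₁ M M₁) (E₂ : ReductIso A₂ M M₂),
      ∀ c ∈ C, ∃ x, E₁.map S x = M₁.const S c ∧ E₂.map S x = M₂.const S c := by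
  classical
  choose X e₁ e₂ hX hb₁ hb₂ hc using exists_merged_carrier h hE₁ hE₂ hM₁ hM₂
  -- A single value has to be right for both structures. A shared symbol is a constant from `C`,
  -- whose two values have a common preimage; for any other symbol at most one condition is active,
  -- and surjectivity pulls its value back.
  have hfn : ∀ (f : FunSym) (args : ∀ i : Fin (FunSym.dom f).length, X ((FunSym.dom f).get i)),
      ∃ y : X (FunSym.cod f),
        (f ∈ A₁.funs → e₁ _ y = M₁.fn f (fun i => e₁ _ (args i))) ∧
        (f ∈ A₂.funs → e₂ _ y = M₂.fn f (fun i => e₂ _ (args i))) := by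
    intro f args
    by_cases h₁ : f ∈ A₁.funs
    · by_cases h₂ : f ∈ A₂.funs
      · obtain ⟨c, hcC, rfl⟩ := exists_const_of_mem h h₁ h₂
        obtain ⟨x, hx₁, hx₂⟩ := hc S rfl c hcC
        refine ⟨x, fun _ => hx₁.trans ?_, fun _ => hx₂.trans ?_⟩
        · exact congrArg (M₁.fn (constSym S c)) (funext fun i => i.elim0)
        · exact congrArg (M₂.fn (constSym S c)) (funext fun i => i.elim0)
      · obtain ⟨y, hy⟩ := (hb₁ _ (A₁.cod_mem f h₁)).2 (M₁.fn f (fun i => e₁ _ (args i)))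
        exact ⟨y, fun _ => hy, fun h' => absurd h' h₂⟩
    · by_cases h₂ : f ∈ A₂.funs
      · obtain ⟨y, hy⟩ := (hb₂ _ (A₂.cod_mem f h₂)).2 (M₂.fn f (fun i => e₂ _ (args i)))
        exact ⟨y, fun h' => absurd h' h₁, fun _ => hy⟩
      · exact ⟨(hX _).some, fun h' => absurd h' h₁, fun h' => absurd h' h₂⟩
  choose F hF₁ hF₂ using hfn
  -- No predicate symbol is shared, so reading each one in the structure that owns it causes no
  -- conflict.
  let M : Struc := ⟨X, hX, F, fun r args =>
    if r ∈ A₁.rels then M₁.rel r (fun i => e₁ _ (args i)) else M₂.rel r (fun i => e₂ _ (args i))⟩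
  refine ⟨M, ⟨e₁, hb₁, fun f hf args => hF₁ f args hf, fun r hr args => ?_⟩,
    ⟨e₂, hb₂, fun f hf args => hF₂ f args hf, fun r hr args => ?_⟩, fun c hcC => hc S rfl c hcC⟩
  · simp [M, hr]
  · have : r ∉ A₁.rels := fun h₁ => rel_not_mem_both h h₁ hr
    simp [M, this]

/-- A set of pure literals that contains an arrangement of its shared variables is satisfiable in
the union of the theories if its two parts are satisfiable in the two theories. -/
theorem exists_combined (h : A₁.inter A₂ = edtSignature S C) {T₁ T₂ : Set Formula}
    (hT₁ : IsTheory A₁ T₁) (hT₂ : IsTheory A₂ T₂) (hE₁ : EDT S C ⊆ T₁) (hE₂ : EDT S C ⊆ T₂)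
    {Γ : Set Literal} (hpure : ∀ l ∈ Γ, l.1.In A₁ ∨ l.1.In A₂)
    (harr : ∀ l ∈ Γ, ∀ x ∈ l.1.vars, Var.sort x = S → ∃ c ∈ C, (Atom.eqConst x c, true) ∈ Γ)
    {M₁ M₂ : Struc} (hM₁ : M₁.Models T₁) (hM₂ : M₂.Models T₂) {v₁ : M₁.Val} {v₂ : M₂.Val}
    (h₁ : ∀ l ∈ Γ, l.1.In A₁ → Literal.Holds M₁ v₁ l)
    (h₂ : ∀ l ∈ Γ, l.1.In A₂ → Literal.Holds M₂ v₂ l) :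
    ∃ M : Struc, M.Models (T₁ ∪ T₂) ∧ ∃ v : M.Val, ∀ l ∈ Γ, Literal.Holds M v l := by
  classical
  obtain ⟨M, E₁, E₂, hc⟩ := exists_merged h hE₁ hE₂ hM₁ hM₂
  have hval : ∀ x : Var, ∃ d : M.carrier (Var.sort x),
      (∀ l ∈ Γ, l.1.In A₁ → x ∈ l.1.vars → Var.sort x ∈ A₁.sorts → E₁.map _ d = v₁ x) ∧
      (∀ l ∈ Γ, l.1.In A₂ → x ∈ l.1.vars → Var.sort x ∈ A₂.sorts → E₂.map _ d = v₂ x) := by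
    intro x
    -- For an occurring variable of sort `S`, the equation `x = c` is over both signatures and so
    -- holds on both sides; the common preimage of the two values of `c` serves. In the other case
    -- the two requirements on `d` cannot both be active.
    by_cases hx : Var.sort x = S ∧ ∃ l ∈ Γ, x ∈ l.1.vars
    · obtain ⟨rfl, l, hl, hxl⟩ := hx
      obtain ⟨c, hcC, hlit⟩ := harr l hl x hxl rfl
      obtain ⟨d, hd₁, hd₂⟩ := hc c hcC
      have a₁ := h₁ _ hlit (Atom.in_eqConst (const_mem_both h hcC).1)
      have a₂ := h₂ _ hlit (Atom.in_eqConst (const_mem_both h hcC).2)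
      rw [Literal.Holds, if_pos rfl, Atom.holds_eqConst] at a₁ a₂
      exact ⟨d, fun _ _ _ _ _ => hd₁.trans a₁.symm, fun _ _ _ _ _ => hd₂.trans a₂.symm⟩
    · by_cases hx₁ : Var.sort x ∈ A₁.sorts
      · obtain ⟨d, hd⟩ := (E₁.bijective _ hx₁).2 (v₁ x)
        exact ⟨d, fun _ _ _ _ _ => hd, fun l hl _ hxl hx₂ =>
          absurd ⟨sort_eq_of_mem h hx₁ hx₂, l, hl, hxl⟩ hx⟩
      · by_cases hx₂ : Var.sort x ∈ A₂.sorts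
        · obtain ⟨d, hd⟩ := (E₂.bijective _ hx₂).2 (v₂ x)
          exact ⟨d, fun _ _ _ _ h' => absurd h' hx₁, fun _ _ _ _ _ => hd⟩
        · exact ⟨(M.nonempty _).some, fun _ _ _ _ h' => absurd h' hx₁,
            fun _ _ _ _ h' => absurd h' hx₂⟩
  choose v hv₁ hv₂ using hval
  refine ⟨M, fun φ hφ => hφ.elim (hM₁.of_reductIso E₁ hT₁ φ) (hM₂.of_reductIso E₂ hT₂ φ), v,
    fun l hl => ?_⟩
  rcases hpure l hl with hA | hA
  · exact (Literal.holds_iff E₁ l hA fun x hx =>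
      hv₁ x l hl hA hx (Atom.sort_mem_of_mem_vars hA hx)).2 (h₁ l hl hA)
  · exact (Literal.holds_iff E₂ l hA fun x hx =>
      hv₂ x l hl hA hx (Atom.sort_mem_of_mem_vars hA hx)).2 (h₂ l hl hA)

end Combination

/-! Unique readability of words. -/

/-- Postfix words are decoded from the right: the last block is split off first. The prefixes `a`
and `b` are arbitrary because they absorb the blocks not yet read. -/
theorem append_flatten_ofFn_inj {β : Type*} {n : ℕ} {F G : Fin n → List β} {R : Fin n → Prop}
    (h : ∀ i a b, a ++ F i = b ++ G i → R i ∧ a = b) {a b : List β}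
    (hab : a ++ (List.ofFn F).flatten = b ++ (List.ofFn G).flatten) : (∀ i, R i) ∧ a = b := by
  induction n with
  | zero => exact ⟨fun i => i.elim0, by simpa using hab⟩
  | succ n ih =>
    simp only [List.ofFn_succ', List.concat_eq_append, List.flatten_append, List.flatten_cons,
      List.flatten_nil, List.append_nil, ← List.append_assoc] at hab
    obtain ⟨hl, hab⟩ := h _ _ _ hab
    obtain ⟨hi, hab⟩ := ih (R := fun i => R i.castSucc) (fun i => h i.castSucc) hab
    exact ⟨Fin.lastCases hl hi, hab⟩

/-- The last token is the head symbol, which carries its rank and thus fixes the number and the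
sorts of the arguments to be read before it. -/
theorem Term.append_code_inj {s s' : ℕ} (t : Term s) (u : Term s') {a b : List Token}
    (h : a ++ t.code = b ++ u.code) : (⟨s, t⟩ : Σ s, Term s) = ⟨s', u⟩ ∧ a = b := by
  induction t generalizing s' a b with
  | var x =>
    cases u with
    | var y =>
      simp only [Term.code] at h
      obtain ⟨rfl, h⟩ := List.append_inj' h rfl
      have : x = y := by simpa using h
      subst this
      exact ⟨rfl, rfl⟩
    | app g us =>
      simp only [Term.code, ← List.append_assoc] at h
      have := (List.append_inj' h rfl).2
      simp at this
  | app f ts ih =>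
    cases u with
    | var y =>
      simp only [Term.code, ← List.append_assoc] at h
      have := (List.append_inj' h rfl).2
      simp at this
    | app g us =>
      simp only [Term.code, ← List.append_assoc] at h
      obtain ⟨h, hfg⟩ := List.append_inj' h rfl
      have : f = g := by simpa using hfg
      subst this
      obtain ⟨hi, hab⟩ := append_flatten_ofFn_inj (R := fun i => ts i = us i)
        (fun i a b hab => by
          obtain ⟨h₁, h₂⟩ := ih i (us i) hab
          exact ⟨eq_of_heq (Sigma.mk.inj h₁).2, h₂⟩) h
      rw [funext hi]
      exact ⟨rfl, hab⟩

theorem Term.code_inj {s s' : ℕ} {t : Term s} {u : Term s'} (h : t.code = u.code) :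
    (⟨s, t⟩ : Σ s, Term s) = ⟨s', u⟩ :=
  (Term.append_code_inj t u (a := []) (b := []) h).1

/-- `purifyName` locates words with `List.idxOf`, whose injectivity needs lawful Boolean equality on
tokens, and these are sums. -/
instance sumLawfulBEq {α β : Type*} [BEq α] [BEq β] [LawfulBEq α] [LawfulBEq β] :
    LawfulBEq (α ⊕ β) where
  rfl := by
    rintro (a | b)
    · exact beq_self_eq_true a
    · exact beq_self_eq_true b
  eq_of_beq := by
    rintro (a | a) (b | b) h
    · exact congrArg Sum.inl (eq_of_beq (a := a) (b := b) h)
    · cases h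
    · cases h
    · exact congrArg Sum.inr (eq_of_beq (a := a) (b := b) h)

/-! Purification. -/

section Purification

variable {sig : Side → Signature} {name : List Token → ℕ}

/-- The union of the two signatures. -/
abbrev wholeSig (sig : Side → Signature) : Signature := (sig .wf).union (sig .pm)

theorem mem_funs_other {f : FunSym} (h : f ∈ (wholeSig sig).funs) {L : Side}
    (hL : f ∉ (sig L).funs) : f ∈ (sig L.other).funs := by
  cases L
  · exact h.resolve_left hL
  · exact h.resolve_right hL

/-- The name of an alien subterm has the sort of the place where it stands. This place is the root,
whose sort is in the signature by `hs`, or an argument place of a symbol of the side `L`. -/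
theorem Term.pure_in {s : ℕ} (t : Term s) (ht : t.In (wholeSig sig)) (L : Side)
    (hs : s ∈ (sig L).sorts) : (t.pure sig name L).In (sig L) := by
  induction t with
  | var x => simpa [Term.pure, Term.In] using hs
  | app f ts ih =>
    rw [Term.In] at ht
    rw [Term.pure]
    split_ifs with hf
    · rw [Term.In]
      exact ⟨hf, fun i => ih i (ht.2 i) ((sig L).dom_mem f hf _ (List.get_mem _ _))⟩
    · simpa [Term.In] using hs

theorem Term.aliens_app_of_mem {f : FunSym} {ts : ∀ i : Fin (FunSym.dom f).length,
    Term ((FunSym.dom f).get i)} {L : Side} (hf : f ∈ (sig L).funs) :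
    (Term.app f ts).aliens sig L = (List.ofFn fun i => (ts i).aliens sig L).flatten := by
  rw [Term.aliens, if_pos hf]

theorem Term.aliens_app_of_notMem {f : FunSym} {ts : ∀ i : Fin (FunSym.dom f).length,
    Term ((FunSym.dom f).get i)} {L : Side} (hf : f ∉ (sig L).funs) :
    (Term.app f ts).aliens sig L = (L.other, ⟨FunSym.cod f, .app f ts⟩) ::
        (List.ofFn fun i => (ts i).aliens sig L.other).flatten := by
  rw [Term.aliens, if_neg hf]

theorem mem_flatten_ofFn {β : Type*} {n : ℕ} {F : Fin n → List β} {x : β} :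
    x ∈ (List.ofFn F).flatten ↔ ∃ i, x ∈ F i := by
  simp [List.mem_flatten, List.mem_ofFn]

/-- The alien subterms are well-placed subterms, and their own alien subterms are among them. -/
theorem Term.alien_spec {s : ℕ} (t : Term s) (ht : t.In (wholeSig sig)) (L : Side) (p : Alien)
    (hp : p ∈ t.aliens sig L) :
    p.term.In (wholeSig sig) ∧ p.2.1 ∈ (sig p.1).sorts ∧ p.term.vars ⊆ t.vars ∧
      p.term.aliens sig p.1 ⊆ t.aliens sig L := by
  induction t generalizing L with
  | var x => simp [Term.aliens] at hp
  | app f ts ih =>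
    have ht' := ht
    rw [Term.In] at ht'
    by_cases hf : f ∈ (sig L).funs
    · rw [Term.aliens_app_of_mem hf] at hp ⊢
      obtain ⟨i, hi⟩ := mem_flatten_ofFn.1 hp
      obtain ⟨h₁, h₂, h₃, h₄⟩ := ih i (ht'.2 i) L hi
      exact ⟨h₁, h₂, fun x hx => Term.mem_vars_app.2 ⟨i, h₃ hx⟩,
        fun q hq => mem_flatten_ofFn.2 ⟨i, h₄ hq⟩⟩
    · have hf' := mem_funs_other ht'.1 hf
      rw [Term.aliens_app_of_notMem hf] at hp ⊢
      rcases List.mem_cons.1 hp with rfl | hp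
      · refine ⟨ht, (sig L.other).cod_mem f hf', fun x hx => hx, fun q hq => ?_⟩
        -- The head of the alien subterm belongs to the other side, so its own aliens are those of
        -- its arguments.
        rw [Alien.term, Term.aliens_app_of_mem hf'] at hq
        exact List.mem_cons_of_mem _ hq
      · obtain ⟨i, hi⟩ := mem_flatten_ofFn.1 hp
        obtain ⟨h₁, h₂, h₃, h₄⟩ := ih i (ht'.2 i) L.other hi
        exact ⟨h₁, h₂, fun x hx => Term.mem_vars_app.2 ⟨i, h₃ hx⟩,
          fun q hq => List.mem_cons_of_mem _ (mem_flatten_ofFn.2 ⟨i, h₄ hq⟩)⟩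

/-- The variable that names an alien subterm. -/
abbrev Alien.nameVar (name : List Token → ℕ) (p : Alien) : Var := (name p.term.code, p.2.1)

/-- Two valuations are needed: `w` is `v` when a model of the purified formula is read back, and an
extension by values of the names when such a model is built. -/
theorem Term.eval_pure {M : Struc} {v w : M.Val} {s : ℕ} (t : Term s) (L : Side)
    (hv : ∀ x ∈ t.vars, w x = v x)
    (hp : ∀ p ∈ t.aliens sig L, w (p.nameVar name) = p.term.eval M v) :
    (t.pure sig name L).eval M w = t.eval M v := by
  induction t with
  | var x =>
    rw [Term.pure, Term.eval, Term.eval]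
    exact hv x (by simp [Term.vars])
  | app f ts ih =>
    rw [Term.pure]
    split_ifs with hf
    · rw [Term.aliens_app_of_mem hf] at hp
      rw [Term.eval, Term.eval]
      congr 1
      funext i
      exact ih i (fun x hx => hv x (Term.mem_vars_app.2 ⟨i, hx⟩))
        fun p h => hp p (mem_flatten_ofFn.2 ⟨i, h⟩)
    · rw [Term.aliens_app_of_notMem hf] at hp
      rw [Term.eval]
      exact hp _ (List.mem_cons_self ..)

theorem Alien.holds_definition {M : Struc} {v : M.Val} {p : Alien} :
    (p.definition sig name).Holds M v ↔
      v (p.nameVar name) = (p.term.pure sig name p.1).eval M v := by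
  rw [Alien.definition, Atom.Holds, Term.eval]

/-- The defining equations determine the names from the inside out: the right side for an alien
subterm mentions only names of aliens inside its arguments, and these are correct by induction. -/
theorem Term.eval_name_of_definitions {M : Struc} {v : M.Val} {s : ℕ} (t : Term s)
    (ht : t.In (wholeSig sig)) (L : Side)
    (hd : ∀ p ∈ t.aliens sig L, (p.definition sig name).Holds M v) (p : Alien)
    (hp : p ∈ t.aliens sig L) : v (p.nameVar name) = p.term.eval M v := by
  induction t generalizing L p with
  | var x => simp [Term.aliens] at hp
  | app f ts ih =>
    rw [Term.In] at ht
    by_cases hf : f ∈ (sig L).funs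
    · rw [Term.aliens_app_of_mem hf] at hp hd
      obtain ⟨i, hi⟩ := mem_flatten_ofFn.1 hp
      exact ih i (ht.2 i) L (fun q hq => hd q (mem_flatten_ofFn.2 ⟨i, hq⟩)) p hi
    · have hf' := mem_funs_other ht.1 hf
      rw [Term.aliens_app_of_notMem hf] at hp hd
      have key : ∀ q ∈ (List.ofFn fun i => (ts i).aliens sig L.other).flatten,
          v (q.nameVar name) = q.term.eval M v := by
        intro q hq
        obtain ⟨i, hi⟩ := mem_flatten_ofFn.1 hq
        exact ih i (ht.2 i) L.other
          (fun q hq => hd q (List.mem_cons_of_mem _ (mem_flatten_ofFn.2 ⟨i, hq⟩))) q hi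
      rcases List.mem_cons.1 hp with rfl | hp
      · have := Alien.holds_definition.1 (hd _ (List.mem_cons_self ..))
        rw [this]
        refine Term.eval_pure _ _ (fun _ _ => rfl) ?_
        dsimp only [Alien.term]
        rw [Term.aliens_app_of_mem hf']
        exact key
      · exact key p hp

/-- An equation whose sort belongs to the first level is sent to the second only if both terms are
over the second signature, and then so is their sort. -/
theorem Atom.side_spec {α : Atom} (h : α.In (wholeSig sig)) :
    match α with
    | .equal (s := s) _ _ => s ∈ (sig (α.side sig)).sorts
    | .rel r _ => r ∈ (sig (α.side sig)).rels := by
  cases α with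
  | @equal s t u =>
    simp only [Atom.side]
    split_ifs with hs
    · exact hs.1
    · by_cases hw : s ∈ (sig .wf).sorts
      · by_contra hn
        exact hs ⟨hw, fun h' => hn (Term.sort_mem h'.1)⟩
      · exact (Term.sort_mem h.1).resolve_left hw
  | rel r ts =>
    simp only [Atom.side]
    split_ifs with hr
    · exact hr
    · exact h.1.resolve_left hr

theorem Atom.pure_in {α : Atom} (h : α.In (wholeSig sig)) :
    (α.pure sig name).In (sig (α.side sig)) := by
  have hs := Atom.side_spec h
  cases α with
  | equal t u => exact ⟨t.pure_in h.1 _ hs, u.pure_in h.2 _ hs⟩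
  | rel r ts =>
    exact ⟨hs, fun i => (ts i).pure_in (h.2 i) _ ((sig _).rel_mem r hs _ (List.get_mem _ _))⟩

theorem Atom.alien_spec {α : Atom} (h : α.In (wholeSig sig)) (p : Alien)
    (hp : p ∈ α.aliens sig) :
    p.term.In (wholeSig sig) ∧ p.2.1 ∈ (sig p.1).sorts ∧ p.term.vars ⊆ α.vars ∧
      p.term.aliens sig p.1 ⊆ α.aliens sig := by
  cases α with
  | equal t u =>
    simp only [Atom.aliens, Atom.vars, List.mem_append] at hp ⊢
    rcases hp with hp | hp
    · obtain ⟨h₁, h₂, h₃, h₄⟩ := t.alien_spec h.1 _ p hp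
      exact ⟨h₁, h₂, fun x hx => List.mem_append_left _ (h₃ hx),
        fun q hq => List.mem_append_left _ (h₄ hq)⟩
    · obtain ⟨h₁, h₂, h₃, h₄⟩ := u.alien_spec h.2 _ p hp
      exact ⟨h₁, h₂, fun x hx => List.mem_append_right _ (h₃ hx),
        fun q hq => List.mem_append_right _ (h₄ hq)⟩
  | rel r ts =>
    simp only [Atom.aliens] at hp ⊢
    obtain ⟨i, hi⟩ := mem_flatten_ofFn.1 hp
    obtain ⟨h₁, h₂, h₃, h₄⟩ := (ts i).alien_spec (h.2 i) _ p hi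
    exact ⟨h₁, h₂, fun x hx => Atom.mem_vars_rel.2 ⟨i, h₃ hx⟩,
      fun q hq => mem_flatten_ofFn.2 ⟨i, h₄ hq⟩⟩

theorem Atom.holds_pure {M : Struc} {v w : M.Val} (α : Atom) (hv : ∀ x ∈ α.vars, w x = v x)
    (hp : ∀ p ∈ α.aliens sig, w (p.nameVar name) = p.term.eval M v) :
    (α.pure sig name).Holds M w ↔ α.Holds M v := by
  cases α with
  | equal t u =>
    simp only [Atom.aliens, Atom.vars, List.mem_append] at hp hv
    simp only [Atom.pure, Atom.Holds]
    rw [t.eval_pure _ (fun x hx => hv x (Or.inl hx)) fun p h => hp p (Or.inl h),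
      u.eval_pure _ (fun x hx => hv x (Or.inr hx)) fun p h => hp p (Or.inr h)]
  | rel r ts =>
    simp only [Atom.aliens] at hp
    simp only [Atom.pure, Atom.Holds]
    have : (fun i => ((ts i).pure sig name ((Atom.rel r ts).side sig)).eval M w) =
        fun i => (ts i).eval M v := by
      funext i
      exact (ts i).eval_pure _ (fun x hx => hv x (Atom.mem_vars_rel.2 ⟨i, hx⟩))
        fun p h => hp p (mem_flatten_ofFn.2 ⟨i, h⟩)
    rw [this]

theorem Atom.eval_name_of_definitions {M : Struc} {v : M.Val} {α : Atom}
    (h : α.In (wholeSig sig)) (hd : ∀ p ∈ α.aliens sig, (p.definition sig name).Holds M v)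
    (p : Alien) (hp : p ∈ α.aliens sig) : v (p.nameVar name) = p.term.eval M v := by
  cases α with
  | equal t u =>
    simp only [Atom.aliens, List.mem_append] at hp hd
    rcases hp with hp | hp
    · exact t.eval_name_of_definitions h.1 _ (fun q hq => hd q (Or.inl hq)) p hp
    · exact u.eval_name_of_definitions h.2 _ (fun q hq => hd q (Or.inr hq)) p hp
  | rel r ts =>
    simp only [Atom.aliens] at hp hd
    obtain ⟨i, hi⟩ := mem_flatten_ofFn.1 hp
    exact (ts i).eval_name_of_definitions (h.2 i) _
      (fun q hq => hd q (mem_flatten_ofFn.2 ⟨i, hq⟩)) p hi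

theorem QF.mem_vars {φ : QF} {x : Var} : x ∈ φ.vars ↔ ∃ α ∈ φ.atoms, x ∈ α.vars := by
  induction φ with
  | tru => simp [QF.vars, QF.atoms]
  | atom α => simp [QF.vars, QF.atoms]
  | not φ ih => simpa [QF.vars, QF.atoms] using ih
  | and φ ψ ih ih' => simp [QF.vars, QF.atoms, ih, ih', or_and_right, exists_or]
  | or φ ψ ih ih' => simp [QF.vars, QF.atoms, ih, ih', or_and_right, exists_or]

theorem QF.mem_aliens {φ : QF} {p : Alien} :
    p ∈ φ.aliens sig ↔ ∃ α ∈ φ.atoms, p ∈ α.aliens sig := by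
  induction φ with
  | tru => simp [QF.aliens, QF.atoms]
  | atom α => simp [QF.aliens, QF.atoms]
  | not φ ih => simpa [QF.aliens, QF.atoms] using ih
  | and φ ψ ih ih' => simp [QF.aliens, QF.atoms, ih, ih', or_and_right, exists_or]
  | or φ ψ ih ih' => simp [QF.aliens, QF.atoms, ih, ih', or_and_right, exists_or]

theorem QF.in_iff {A : Signature} {φ : QF} : φ.In A ↔ ∀ α ∈ φ.atoms, α.In A := by
  induction φ with
  | tru => simp [QF.In, QF.atoms]
  | atom α => simp [QF.In, QF.atoms]
  | not φ ih => simpa [QF.In, QF.atoms] using ih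
  | and φ ψ ih ih' => simp [QF.In, QF.atoms, ih, ih', or_imp, forall_and]
  | or φ ψ ih ih' => simp [QF.In, QF.atoms, ih, ih', or_imp, forall_and]

theorem QF.atoms_pure (φ : QF) : (φ.pure sig name).atoms = φ.atoms.map (Atom.pure sig name) := by
  induction φ with
  | tru => rfl
  | atom α => rfl
  | not φ ih => simpa [QF.pure, QF.atoms] using ih
  | and φ ψ ih ih' => simp [QF.pure, QF.atoms, ih, ih']
  | or φ ψ ih ih' => simp [QF.pure, QF.atoms, ih, ih']

theorem QF.holds_pure {M : Struc} {v w : M.Val} (φ : QF)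
    (h : ∀ α ∈ φ.atoms, ((α.pure sig name).Holds M w ↔ α.Holds M v)) :
    (φ.pure sig name).Holds M w ↔ φ.Holds M v := by
  induction φ with
  | tru => rfl
  | atom α => exact h α (by simp [QF.atoms])
  | not φ ih => exact not_congr (ih h)
  | and φ ψ ih ih' =>
    simp only [QF.atoms, List.mem_append] at h
    exact and_congr (ih fun α hα => h α (Or.inl hα)) (ih' fun α hα => h α (Or.inr hα))
  | or φ ψ ih ih' =>
    simp only [QF.atoms, List.mem_append] at h
    exact or_congr (ih fun α hα => h α (Or.inl hα)) (ih' fun α hα => h α (Or.inr hα))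

theorem QF.holds_conj {M : Struc} {v : M.Val} {l : List QF} :
    (QF.conj l).Holds M v ↔ ∀ φ ∈ l, φ.Holds M v := by
  induction l with
  | nil => simp [QF.conj, QF.Holds]
  | cons φ l ih => simp [QF.conj, QF.Holds, ih]

theorem QF.mem_atoms_conj {l : List QF} {α : Atom} :
    α ∈ (QF.conj l).atoms ↔ ∃ φ ∈ l, α ∈ φ.atoms := by
  induction l with
  | nil => simp [QF.conj, QF.atoms]
  | cons φ l ih => simp [QF.conj, QF.atoms, ih]

theorem holds_purify {M : Struc} {v : M.Val} {φ : QF} :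
    (purify sig φ).Holds M v ↔ (φ.pure sig (purifyName sig φ)).Holds M v ∧
      ∀ p ∈ φ.aliens sig, (p.definition sig (purifyName sig φ)).Holds M v := by
  rw [purify, QF.Holds, QF.holds_conj, List.forall_mem_map]
  rfl

theorem mem_atoms_purify {φ : QF} {α : Atom} :
    α ∈ (purify sig φ).atoms ↔ (∃ β ∈ φ.atoms, β.pure sig (purifyName sig φ) = α) ∨
      ∃ p ∈ φ.aliens sig, p.definition sig (purifyName sig φ) = α := by
  simp [purify, QF.atoms, QF.atoms_pure, QF.mem_atoms_conj, eq_comm]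

/-- The atoms of the purified formula are pure. -/
theorem exists_side_of_mem_atoms_purify {φ : QF} (hφ : φ.In (wholeSig sig)) {α : Atom}
    (hα : α ∈ (purify sig φ).atoms) : ∃ L, α.In (sig L) := by
  rw [QF.in_iff] at hφ
  rcases mem_atoms_purify.1 hα with ⟨β, hβ, rfl⟩ | ⟨p, hp, rfl⟩
  · exact ⟨_, Atom.pure_in (hφ β hβ)⟩
  · obtain ⟨β, hβ, hp⟩ := QF.mem_aliens.1 hp
    obtain ⟨h₁, h₂, -, -⟩ := Atom.alien_spec (hφ β hβ) p hp
    refine ⟨p.1, ?_, p.term.pure_in h₁ _ h₂⟩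
    rw [Term.In]
    exact h₂

theorem lt_purifyName {φ : QF} {x : Var} (hx : x ∈ φ.vars) (w : List Token) :
    x.1 < purifyName sig φ w := by
  have : ∀ l : List ℕ, ∀ n ∈ l, n ≤ l.foldr max 0 := by
    intro l
    induction l with
    | nil => simp
    | cons a l ih =>
      intro n hn
      rcases List.mem_cons.1 hn with rfl | hn
      · exact le_max_left _ _
      · exact (ih n hn).trans (le_max_right _ _)
  have := this _ _ (List.mem_map_of_mem (f := Var.name) hx)
  unfold purifyName
  simp only [Var.name] at this
  omega

/-- The word of `p` is in the list, so equal positions mean equal words, and words are uniquely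
readable. They do not record the side, hence only sort and term are recovered. -/
theorem purifyName_inj {φ : QF} {p q : Alien} (hp : p ∈ φ.aliens sig)
    (h : purifyName sig φ p.term.code = purifyName sig φ q.term.code) : p.2 = q.2 := by
  have hmem : p.term.code ∈ (φ.aliens sig).map (fun p => p.term.code) :=
    List.mem_map.2 ⟨p, hp, rfl⟩
  exact Term.code_inj (t := p.term) (u := q.term)
    ((List.idxOf_inj hmem).1 (Nat.add_left_cancel h))

/-- Purification preserves satisfiability. -/
theorem exists_holds_purify_iff {M : Struc} {φ : QF} (hφ : φ.In (wholeSig sig)) :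
    (∃ v, (purify sig φ).Holds M v) ↔ ∃ v, φ.Holds M v := by
  rw [QF.in_iff] at hφ
  constructor
  · rintro ⟨v, hv⟩
    obtain ⟨hv, hd⟩ := holds_purify.1 hv
    refine ⟨v, (QF.holds_pure φ fun α hα => ?_).1 hv⟩
    refine Atom.holds_pure α (fun _ _ => rfl) (Atom.eval_name_of_definitions (hφ α hα) ?_)
    exact fun p hp => hd p (QF.mem_aliens.2 ⟨α, hα, hp⟩)
  · rintro ⟨v, hv⟩
    -- The new valuation gives a name the value of the subterm it names and keeps `v` elsewhere.
    -- Freshness excludes a clash with the variables of `φ`, and `purifyName_inj` a clash between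
    -- names. `HEq` is used because the sorts match only after rewriting with the equation for `x`.
    have hval : ∀ x : Var, ∃ d : M.carrier (Var.sort x),
        (x ∈ φ.vars → d = v x) ∧
        ∀ p ∈ φ.aliens sig, x = p.nameVar (purifyName sig φ) → HEq d (p.term.eval M v) := by
      intro x
      by_cases hx : ∃ p ∈ φ.aliens sig, x = p.nameVar (purifyName sig φ)
      · obtain ⟨p, hp, rfl⟩ := hx
        refine ⟨p.term.eval M v, fun hx => absurd (lt_purifyName hx _) (lt_irrefl _), ?_⟩
        intro q hq h
        have := purifyName_inj hp (Prod.ext_iff.1 h).1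
        obtain ⟨L, s, t⟩ := p
        obtain ⟨L', s', t'⟩ := q
        cases this
        rfl
      · exact ⟨v x, fun _ => rfl, fun p hp h => absurd ⟨p, hp, h⟩ hx⟩
    choose w hw₁ hw₂ using hval
    have hn : ∀ p ∈ φ.aliens sig, w (p.nameVar (purifyName sig φ)) = p.term.eval M v :=
      fun p hp => eq_of_heq (hw₂ _ p hp rfl)
    refine ⟨w, holds_purify.2 ⟨(QF.holds_pure φ fun α hα => ?_).2 hv, fun p hp => ?_⟩⟩
    · exact Atom.holds_pure α (fun x hx => hw₁ x (QF.mem_vars.2 ⟨α, hα, hx⟩))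
        fun p hp => hn p (QF.mem_aliens.2 ⟨α, hα, hp⟩)
    · obtain ⟨α, hα, hpα⟩ := QF.mem_aliens.1 hp
      obtain ⟨-, -, h₃, h₄⟩ := Atom.alien_spec (hφ α hα) p hpα
      -- Both sides of the defining equation take the value of the alien subterm under `v`.
      rw [Alien.holds_definition, hn p hp]
      refine (Term.eval_pure _ _ (fun x hx => hw₁ x (QF.mem_vars.2 ⟨α, hα, h₃ hx⟩))
        fun q hq => hn q (QF.mem_aliens.2 ⟨α, hα, h₄ hq⟩)).symm

end Purification

/-! ### Boolean abstraction and learned clauses -/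

theorem QF.boolEval_congr {σ τ : Atom → Bool} {φ : QF} (h : ∀ α ∈ φ.atoms, σ α = τ α) :
    φ.boolEval σ = φ.boolEval τ := by
  induction φ with
  | tru => rfl
  | atom α => exact h α (by simp [QF.atoms])
  | not φ ih => simp only [QF.boolEval, ih h]
  | and φ ψ ih ih' =>
    simp only [QF.atoms, List.mem_append] at h
    simp only [QF.boolEval, ih fun α hα => h α (Or.inl hα), ih' fun α hα => h α (Or.inr hα)]
  | or φ ψ ih ih' =>
    simp only [QF.atoms, List.mem_append] at h
    simp only [QF.boolEval, ih fun α hα => h α (Or.inl hα), ih' fun α hα => h α (Or.inr hα)]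

theorem QF.boolEval_iff_holds {M : Struc} {v : M.Val} {σ : Atom → Bool} {φ : QF}
    (h : ∀ α ∈ φ.atoms, (σ α = true ↔ α.Holds M v)) : φ.boolEval σ = true ↔ φ.Holds M v := by
  induction φ with
  | tru => simp [QF.boolEval, QF.Holds]
  | atom α => exact h α (by simp [QF.atoms])
  | not φ ih => simp [QF.boolEval, QF.Holds, ← ih h]
  | and φ ψ ih ih' =>
    simp only [QF.atoms, List.mem_append] at h
    simp [QF.boolEval, QF.Holds, ← ih fun α hα => h α (Or.inl hα),
      ← ih' fun α hα => h α (Or.inr hα)]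
  | or φ ψ ih ih' =>
    simp only [QF.atoms, List.mem_append] at h
    simp [QF.boolEval, QF.Holds, ← ih fun α hα => h α (Or.inl hα),
      ← ih' fun α hα => h α (Or.inr hα)]

theorem boolEval_conj_toQF {σ : Atom → Bool} {π : List Literal} :
    (QF.conj (π.map Literal.toQF)).boolEval σ = true ↔ ∀ l ∈ π, σ l.1 = l.2 := by
  induction π with
  | nil => simp [QF.conj, QF.boolEval]
  | cons l π ih =>
    obtain ⟨α, b⟩ := l
    have : (Literal.toQF (α, b)).boolEval σ = true ↔ σ α = b := by
      cases b <;> simp [Literal.toQF, QF.boolEval]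
    rw [List.map_cons, QF.conj, QF.boolEval, Bool.and_eq_true, ih, this, List.forall_mem_cons]

theorem boolEval_learn {σ : Atom → Bool} {φ : QF} {r : Option (List Literal)} :
    (learn φ r).boolEval σ = true ↔
      φ.boolEval σ = true ∧ ∀ π, r = some π → ¬ ∀ l ∈ π, σ l.1 = l.2 := by
  cases r with
  | none => simp [learn]
  | some π =>
    rw [learn, QF.boolEval, QF.boolEval, Bool.and_eq_true, Bool.not_eq_true', ← Bool.not_eq_true,
      boolEval_conj_toQF]
    simp only [Option.some.injEq, forall_eq']

theorem mem_atoms_learn {φ : QF} {r : Option (List Literal)} {α : Atom}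
    (h : α ∈ (learn φ r).atoms) : α ∈ φ.atoms ∨ ∃ π, r = some π ∧ ∃ l ∈ π, l.1 = α := by
  cases r with
  | none => exact Or.inl h
  | some π =>
    rw [learn, QF.atoms, List.mem_append, QF.atoms, QF.mem_atoms_conj] at h
    refine h.imp id ?_
    rintro ⟨ψ, hψ, hα⟩
    obtain ⟨l, hl, rfl⟩ := List.mem_map.1 hψ
    refine ⟨π, rfl, l, hl, ?_⟩
    unfold Literal.toQF at hα
    split_ifs at hα <;> simp [QF.atoms] at hα <;> exact hα.symm

theorem Literal.holds_mk {M : Struc} {v : M.Val} {α : Atom} {b : Bool} :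
    Literal.Holds M v (α, b) ↔ (b = true ↔ α.Holds M v) := by
  cases b <;> simp [Literal.Holds]

/-! ### Termination and correctness of the loop -/

section Algorithm

variable {sig : Side → Signature} {S : ℕ} {C : List ℕ} {solve : Side → Solver} {φ₀ : QF}

theorem mem_interfaceEqs {α : Atom} :
    α ∈ interfaceEqs S C (sharedConsts sig S φ₀) ↔
      ∃ x ∈ (purify sig φ₀).vars, Var.sort x = S ∧ ∃ c ∈ C, α = Atom.eqConst x c := by
  have hx : ∀ x, x ∈ sharedConsts sig S φ₀ ↔ x ∈ (purify sig φ₀).vars ∧ x.2 = S := by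
    simp [sharedConsts]
  rw [interfaceEqs, List.mem_map]
  constructor
  · rintro ⟨⟨⟨n, s⟩, c⟩, h, rfl⟩
    obtain ⟨h, hc⟩ := List.pair_mem_product.1 h
    obtain ⟨hv, rfl⟩ := (hx _).1 h
    exact ⟨(n, s), hv, rfl, c, hc, rfl⟩
  · rintro ⟨⟨n, s⟩, h, rfl, c, hc, rfl⟩
    exact ⟨((n, s), c), List.pair_mem_product.2 ⟨(hx _).2 ⟨h, rfl⟩, hc⟩, rfl⟩

theorem mem_query {σ : Atom → Bool} {L : Side} {l : Literal} :
    l ∈ query sig S C φ₀ σ L ↔ σ l.1 = l.2 ∧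
      ((l.1 ∈ (purify sig φ₀).atoms ∧ l.1.In (sig L)) ∨
        l.1 ∈ interfaceEqs S C (sharedConsts sig S φ₀)) := by
  obtain ⟨α, b⟩ := l
  simp only [query, litsOf, List.mem_append, List.mem_map, List.mem_filter, decide_eq_true_eq,
    Prod.mk.injEq]
  constructor
  · rintro (⟨_, h, rfl, rfl⟩ | ⟨_, h, rfl, rfl⟩)
    · exact ⟨rfl, Or.inl h⟩
    · exact ⟨rfl, Or.inr h⟩
  · rintro ⟨rfl, h | h⟩
    · exact Or.inl ⟨_, h, rfl, rfl⟩
    · exact Or.inr ⟨_, h, rfl, rfl⟩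

theorem const_mem_side (hsh : (sig .wf).inter (sig .pm) = edtSignature S C) {c : ℕ} (hc : c ∈ C)
    (L : Side) : constSym S c ∈ (sig L).funs := by
  cases L
  · exact (const_mem_both hsh hc).1
  · exact (const_mem_both hsh hc).2

/-- An interface equation consists of a variable of the shared sort and a shared constant, so it may
be passed to either solver. -/
theorem in_of_mem_query (hsh : (sig .wf).inter (sig .pm) = edtSignature S C) {σ : Atom → Bool}
    {L : Side} {l : Literal} (hl : l ∈ query sig S C φ₀ σ L) : l.1.In (sig L) := by
  rcases (mem_query.1 hl).2 with h | h
  · exact h.2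
  · obtain ⟨x, -, rfl, c, hc, h⟩ := mem_interfaceEqs.1 h
    rw [h]
    exact Atom.in_eqConst (const_mem_side hsh hc L)

/-- What the algorithm needs to know about a theory solver. -/
def Solver.Sound (solve : Solver) (A : Signature) (T : Set Formula) : Prop :=
  ∀ Γ π : List Literal, (∀ l ∈ Γ, l.1.In A) → solve Γ = some π →
    (∀ l ∈ π, l ∈ Γ) ∧ ¬ SatLits T π

/-- The atoms that occur in a run of the algorithm. -/
def runAtoms (sig : Side → Signature) (S : ℕ) (C : List ℕ) (φ₀ : QF) : Set Atom :=
  {α | α ∈ (purify sig φ₀).atoms ∨ α ∈ interfaceEqs S C (sharedConsts sig S φ₀)}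

theorem finite_runAtoms : (runAtoms sig S C φ₀).Finite :=
  ((purify sig φ₀).atoms ++ interfaceEqs S C (sharedConsts sig S φ₀)).finite_toSet.subset
    fun α hα => by simpa [runAtoms] using hα

open Classical in
/-- The Boolean models of `φ`, as subsets of a set of atoms. -/
def boolModels (X : Set Atom) (φ : QF) : Set (Set Atom) :=
  {τ | τ ⊆ X ∧ φ.boolEval (fun α => decide (α ∈ τ)) = true}

theorem finite_boolModels {X : Set Atom} (hX : X.Finite) (φ : QF) : (boolModels X φ).Finite :=
  hX.finite_subsets.subset fun _ h => h.1

variable {T : Side → Set Formula}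

/-- Both facts serve termination: a learned clause brings in no atom from outside `runAtoms`, and
`σ` falsifies it. -/
theorem mem_of_mem_conflict (hsh : (sig .wf).inter (sig .pm) = edtSignature S C)
    (hsound : ∀ L, (solve L).Sound (sig L) (T L)) {σ : Atom → Bool} {L : Side} {π : List Literal}
    (hπ : solve L (query sig S C φ₀ σ L) = some π) {l : Literal} (hl : l ∈ π) :
    l.1 ∈ runAtoms sig S C φ₀ ∧ σ l.1 = l.2 := by
  have := mem_query.1 ((hsound L _ _ (fun _ => in_of_mem_query hsh) hπ).1 l hl)
  exact ⟨this.2.imp And.left id, this.1⟩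

/-- The measure is the number of Boolean models of the current formula among the subsets of the
finite set `runAtoms`. -/
theorem acc_loop (hsh : (sig .wf).inter (sig .pm) = edtSignature S C)
    (hsound : ∀ L, (solve L).Sound (sig L) (T L)) (φ : QF)
    (hφ : ∀ α ∈ φ.atoms, α ∈ runAtoms sig S C φ₀) :
    Acc (fun d c => Step sig S C solve φ₀ c d) (.loop φ) := by
  classical
  induction hn : (boolModels (runAtoms sig S C φ₀) φ).ncard using Nat.strong_induction_on
    generalizing φ with
  | _ n ih =>
    have hret : ∀ b, Acc (fun d c => Step sig S C solve φ₀ c d) (.ret b) := fun b =>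
      ⟨_, fun d hd => by cases hd⟩
    refine ⟨_, fun d hd => ?_⟩
    cases hd with
    | unsat _ h => exact hret _
    | sat _ σ h hs => exact hret _
    | conflict _ σ h hs =>
      refine ih _ ?_ _ ?_ rfl
      · rw [← hn]
        refine Set.ncard_lt_ncard ⟨fun τ hτ => ?_, fun hsub => hs ?_⟩
          (finite_boolModels finite_runAtoms φ)
        · exact ⟨hτ.1, (boolEval_learn.1 (boolEval_learn.1 hτ.2).1).1⟩
        -- The lost model is `τ`, the restriction of `σ` to the atoms of the run. If it survived
        -- both clauses, no solver could have returned a conflict set, since `τ` makes all literals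
        -- of such a set true.
        · obtain ⟨τ, hτ⟩ : ∃ τ : Set Atom, ∀ α, α ∈ τ ↔ α ∈ runAtoms sig S C φ₀ ∧ σ α = true :=
            ⟨{α | α ∈ runAtoms sig S C φ₀ ∧ σ α = true}, fun _ => Iff.rfl⟩
          have hag : ∀ α ∈ runAtoms sig S C φ₀, decide (α ∈ τ) = σ α := by
            intro α hα
            simp [hτ, hα]
          have hmem : τ ∈ boolModels (runAtoms sig S C φ₀) φ :=
            ⟨fun α hα => ((hτ α).1 hα).1, (QF.boolEval_congr fun α hα => hag α (hφ α hα)).trans h⟩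
          have hev := boolEval_learn.1 (hsub hmem).2
          have hno : ∀ L, (∀ π, solve L (query sig S C φ₀ σ L) = some π → ¬ ∀ l ∈ π,
              decide (l.1 ∈ τ) = l.2) →
              solve L (query sig S C φ₀ σ L) = none := by
            intro L hL
            by_contra hne
            obtain ⟨π, hπ⟩ := Option.ne_none_iff_exists'.1 hne
            refine hL π hπ fun l hl => ?_
            obtain ⟨h₁, h₂⟩ := mem_of_mem_conflict hsh hsound hπ hl
            exact (hag _ h₁).trans h₂
          rintro (_ | _)
          · exact hno _ (boolEval_learn.1 hev.1).2
          · exact hno _ hev.2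
      · intro α hα
        rcases mem_atoms_learn hα with hα | ⟨π, hπ, l, hl, rfl⟩
        · rcases mem_atoms_learn hα with hα | ⟨π, hπ, l, hl, rfl⟩
          · exact hφ α hα
          · exact (mem_of_mem_conflict hsh hsound hπ hl).1
        · exact (mem_of_mem_conflict hsh hsound hπ hl).1

/-- What the algorithm knows about a configuration. -/
def Config.Valid (T : Set Formula) (ψ : QF) : Config → Prop
  | .loop φ => (∀ σ, φ.boolEval σ = true → ψ.boolEval σ = true) ∧
      ∀ (M : Struc) (v : M.Val), M.Models T → ψ.Holds M v → φ.Holds M v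
  | .ret true => SatQF T ψ
  | .ret false => ¬ SatQF T ψ

/-- The arrangement decides every interface equation, and a model of the first theory gives each
shared variable the value of some constant. So for each such variable some equation occurs
positively, and it occurs in both queries. -/
theorem satQF_of_queries (hsh : (sig .wf).inter (sig .pm) = edtSignature S C)
    (hT : ∀ L, IsTheory (sig L) (T L)) (hE : ∀ L, EDT S C ⊆ T L) (hφ₀ : φ₀.In (wholeSig sig))
    {σ : Atom → Bool} (hσ : (purify sig φ₀).boolEval σ = true)
    (hsat : ∀ L, SatLits (T L) (query sig S C φ₀ σ L)) :
    SatQF (T .wf ∪ T .pm) (purify sig φ₀) := by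
  obtain ⟨M₁, hM₁, v₁, h₁⟩ := hsat .wf
  obtain ⟨M₂, hM₂, v₂, h₂⟩ := hsat .pm
  -- In the union of the two queries, the literals over one signature are exactly those of its own
  -- query.
  have hmem : ∀ (l : Literal) (L : Side), (∃ K, l ∈ query sig S C φ₀ σ K) → l.1.In (sig L) →
      l ∈ query sig S C φ₀ σ L := by
    rintro l L ⟨K, hl⟩ hL
    have := mem_query.1 hl
    exact mem_query.2 ⟨this.1, this.2.imp (fun h => ⟨h.1, hL⟩) id⟩
  obtain ⟨M, hM, v, hv⟩ := exists_combined hsh (hT .wf) (hT .pm) (hE .wf) (hE .pm)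
    (Γ := {l | ∃ L, l ∈ query sig S C φ₀ σ L}) (M₁ := M₁) (M₂ := M₂) (v₁ := v₁) (v₂ := v₂)
    (by
      rintro l ⟨_ | _, hl⟩
      · exact Or.inl (in_of_mem_query hsh hl)
      · exact Or.inr (in_of_mem_query hsh hl))
    (by
      rintro l ⟨L, hl⟩ x hx rfl
      have hxv : x ∈ (purify sig φ₀).vars := by
        rcases (mem_query.1 hl).2 with h | h
        · exact QF.mem_vars.2 ⟨_, h.1, hx⟩
        · obtain ⟨y, hy, -, c, -, h⟩ := mem_interfaceEqs.1 h
          rw [h, Atom.vars, List.mem_append] at hx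
          rcases hx with hx | hx
          · rw [Term.vars, List.mem_singleton] at hx
            rwa [hx]
          · rw [Term.const, Term.mem_vars_app] at hx
            exact hx.choose.elim0
      -- `c` names the value of `x` in `M₁`. The query contains `x = c` with the sign given by `σ`,
      -- and `M₁` satisfies the query, so the sign is positive.
      obtain ⟨c, hc, hxc⟩ := hM₁.exists_const (hE .wf) (v₁ x)
      have hmem : Atom.eqConst x c ∈ interfaceEqs (Var.sort x) C
          (sharedConsts sig (Var.sort x) φ₀) := mem_interfaceEqs.2 ⟨x, hxv, rfl, c, hc, rfl⟩
      have := h₁ (Atom.eqConst x c, σ (Atom.eqConst x c)) (mem_query.2 ⟨rfl, Or.inr hmem⟩)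
      rw [Literal.holds_mk, Atom.holds_eqConst] at this
      exact ⟨c, hc, .wf, mem_query.2 ⟨this.2 hxc, Or.inr hmem⟩⟩)
    hM₁ hM₂ (fun l hl hA => h₁ l (hmem l .wf hl hA)) (fun l hl hA => h₂ l (hmem l .pm hl hA))
  refine ⟨M, hM, v, (QF.boolEval_iff_holds fun α hα => ?_).1 hσ⟩
  obtain ⟨L, hL⟩ := exists_side_of_mem_atoms_purify hφ₀ hα
  exact Literal.holds_mk.1 (hv (α, σ α) ⟨L, mem_query.2 ⟨rfl, Or.inl ⟨hα, hL⟩⟩⟩)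

/-- If the learned clause failed in `M`, all literals of the conflict set would hold there, against
its unsatisfiability. The assignment used is the one read off from `M` and `v`. -/
theorem holds_learn (hsh : (sig .wf).inter (sig .pm) = edtSignature S C)
    (hsound : ∀ L, (solve L).Sound (sig L) (T L)) {σ : Atom → Bool} {L : Side} {φ : QF}
    {M : Struc} {v : M.Val} (hM : M.Models (T L)) (h : φ.Holds M v) :
    (learn φ (solve L (query sig S C φ₀ σ L))).Holds M v := by
  classical
  rw [← QF.boolEval_iff_holds (σ := fun α => decide (α.Holds M v)) (by simp)] at h ⊢
  refine boolEval_learn.2 ⟨h, fun π hπ hall => ?_⟩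
  refine (hsound L _ _ (fun _ => in_of_mem_query hsh) hπ).2 ⟨M, hM, v, fun l hl => ?_⟩
  have := hall l hl
  exact Literal.holds_mk.2 (by simp [← this])

/-- The two halves of the loop invariant serve the two answers: for "sat", `σ` also satisfies the
purified formula; for "unsat", a model of the theories would provide a Boolean model of the current
formula. -/
theorem Config.Valid.step (hsh : (sig .wf).inter (sig .pm) = edtSignature S C)
    (hT : ∀ L, IsTheory (sig L) (T L)) (hE : ∀ L, EDT S C ⊆ T L)
    (hsound : ∀ L, (solve L).Sound (sig L) (T L))
    (hsat : ∀ L Γ, (∀ l ∈ Γ, l.1.In (sig L)) → solve L Γ = none → SatLits (T L) Γ)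
    (hφ₀ : φ₀.In (wholeSig sig)) {c d : Config}
    (hc : c.Valid (T .wf ∪ T .pm) (purify sig φ₀)) (hd : Step sig S C solve φ₀ c d) :
    d.Valid (T .wf ∪ T .pm) (purify sig φ₀) := by
  classical
  cases hd with
  | unsat φ h =>
    rintro ⟨M, hM, v, hv⟩
    exact h ⟨fun α => decide (α.Holds M v), (QF.boolEval_iff_holds (by simp)).2 (hc.2 M v hM hv)⟩
  | sat φ σ h hs =>
    exact satQF_of_queries hsh hT hE hφ₀ (hc.1 σ h) fun L =>
      hsat L _ (fun _ => in_of_mem_query hsh) (hs L)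
  | conflict φ σ h hs =>
    refine ⟨fun τ hτ => hc.1 τ (boolEval_learn.1 (boolEval_learn.1 hτ).1).1, fun M v hM hv => ?_⟩
    exact holds_learn hsh hsound (fun ψ hψ => hM ψ (Or.inr hψ))
      (holds_learn hsh hsound (fun ψ hψ => hM ψ (Or.inl hψ)) (hc.2 M v hM hv))

theorem Config.Valid.reaches (hsh : (sig .wf).inter (sig .pm) = edtSignature S C)
    (hT : ∀ L, IsTheory (sig L) (T L)) (hE : ∀ L, EDT S C ⊆ T L)
    (hsound : ∀ L, (solve L).Sound (sig L) (T L))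
    (hsat : ∀ L Γ, (∀ l ∈ Γ, l.1.In (sig L)) → solve L Γ = none → SatLits (T L) Γ)
    (hφ₀ : φ₀.In (wholeSig sig)) {c : Config}
    (hc : Reaches sig S C solve φ₀ (start sig φ₀) c) :
    c.Valid (T .wf ∪ T .pm) (purify sig φ₀) := by
  induction hc with
  | refl => exact ⟨fun _ h => h, fun _ _ _ h => h⟩
  | tail _ hstep ih => exact ih.step hsh hT hE hsound hsat hφ₀ hstep

theorem step_or_ret (c : Config) :
    (∃ d, Step sig S C solve φ₀ c d) ∨ ∃ b, c = .ret b := by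
  cases c with
  | ret b => exact Or.inr ⟨b, rfl⟩
  | loop φ =>
    refine Or.inl ?_
    by_cases h : BoolSat φ
    · obtain ⟨σ, hσ⟩ := h
      by_cases hs : ∀ L, solve L (query sig S C φ₀ σ L) = none
      · exact ⟨_, .sat φ σ hσ hs⟩
      · exact ⟨_, .conflict φ σ hσ hs⟩
    · exact ⟨_, .unsat φ h⟩

theorem exists_reaches_ret {c : Config}
    (hc : Acc (fun d c => Step sig S C solve φ₀ c d) c) :
    ∃ b, Reaches sig S C solve φ₀ c (.ret b) := by
  induction hc with
  | intro c _ ih =>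
    rcases step_or_ret (sig := sig) (S := S) (C := C) (solve := solve) (φ₀ := φ₀) c with
      ⟨d, hd⟩ | ⟨b, rfl⟩
    · obtain ⟨b, hb⟩ := ih d hd
      exact ⟨b, .head hd hb⟩
    · exact ⟨b, .refl⟩

theorem satQF_purify_iff {T : Set Formula} (hφ₀ : φ₀.In (wholeSig sig)) :
    SatQF T (purify sig φ₀) ↔ SatQF T φ₀ :=
  exists_congr fun _ => and_congr_right fun _ => exists_holds_purify_iff hφ₀

end Algorithm

/-! Flattening: every subterm of the substrate sort is replaced with a guessed constant, and every
atom with a guessed truth value. The literals that say that the guesses are right are pure. -/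

/-- The term `u'` of sort `s` becomes the term `u`, and the literals `Δ₀` become `Δ`. -/
def Flatten (S : ℕ) (C : List ℕ) {s : ℕ} (u' : Term s) (Δ₀ : List Literal) (u : Term s)
    (Δ : List Literal) : Prop :=
  if s = S then ∃ c ∈ C, u = Term.const s c ∧ Δ = (Atom.equal u' (Term.const s c), true) :: Δ₀
  else u = u' ∧ Δ = Δ₀

/-- The term `t` becomes the term `u`, under the assumptions `Δ`. -/
def Term.Out (S : ℕ) (C : List ℕ) {s : ℕ} : Term s → Term s → List Literal → Prop
  | .var x, u, Δ => Flatten S C (.var x) [] u Δ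
  | .app f ts, u, Δ => ∃ (us : ∀ i : Fin (FunSym.dom f).length, Term ((FunSym.dom f).get i))
      (Δs : Fin (FunSym.dom f).length → List Literal), (∀ i, (ts i).Out S C (us i) (Δs i)) ∧
      Flatten S C (.app f us) (List.ofFn Δs).reverse.flatten u Δ

/-- The atom has the truth value `b`, under the assumptions `Δ`. -/
def Atom.Out (S : ℕ) (C : List ℕ) : Atom → Bool → List Literal → Prop
  | .equal (s := s) t u, b, Δ => ∃ (t' u' : Term s) (Δ₁ Δ₂ : List Literal), t.Out S C t' Δ₁ ∧
      u.Out S C u' Δ₂ ∧ Δ = (Atom.equal t' u', b) :: (Δ₂ ++ Δ₁)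
  | .rel r ts, b, Δ => ∃ (us : ∀ i : Fin (RelSym.dom r).length, Term ((RelSym.dom r).get i))
      (Δs : Fin (RelSym.dom r).length → List Literal), (∀ i, (ts i).Out S C (us i) (Δs i)) ∧
      Δ = (Atom.rel r us, b) :: (List.ofFn Δs).reverse.flatten

/-- The quantifier-free formula has the truth value `b`, under the assumptions `Δ`. -/
def QF.Out (S : ℕ) (C : List ℕ) : QF → Bool → List Literal → Prop
  | .tru, b, Δ => b = true ∧ Δ = []
  | .atom α, b, Δ => α.Out S C b Δ
  | .not φ, b, Δ => ∃ b', φ.Out S C b' Δ ∧ b = !b'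
  | .and φ ψ, b, Δ => ∃ b₁ b₂ Δ₁ Δ₂, φ.Out S C b₁ Δ₁ ∧ ψ.Out S C b₂ Δ₂ ∧ b = (b₁ && b₂) ∧
      Δ = Δ₂ ++ Δ₁
  | .or φ ψ, b, Δ => ∃ b₁ b₂ Δ₁ Δ₂, φ.Out S C b₁ Δ₁ ∧ ψ.Out S C b₂ Δ₂ ∧ b = (b₁ || b₂) ∧
      Δ = Δ₂ ++ Δ₁

/-- The reversal reflects the order in which the stack machine piles up assumptions; membership does
not depend on it. -/
theorem mem_flatten_reverse_ofFn {β : Type*} {n : ℕ} {F : Fin n → List β} {x : β} :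
    x ∈ (List.ofFn F).reverse.flatten ↔ ∃ i, x ∈ F i := by
  simp [List.mem_flatten, List.mem_ofFn]

theorem Term.vars_const {s c : ℕ} : (Term.const s c).vars = [] := by
  rw [Term.const, Term.vars]
  rfl

section Outcomes

variable {sig : Side → Signature} {S : ℕ} {C : List ℕ}

/-- The literals are pure and contain an arrangement of their shared variables. -/
def Arranged (sig : Side → Signature) (S : ℕ) (C : List ℕ) (Δ : List Literal) : Prop :=
  ∀ l ∈ Δ, (∃ L, l.1.In (sig L)) ∧
    ∀ x ∈ l.1.vars, Var.sort x = S → ∃ c ∈ C, (Atom.eqConst x c, true) ∈ Δ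

theorem Arranged.append {Δ₁ Δ₂ : List Literal} (h₁ : Arranged sig S C Δ₁)
    (h₂ : Arranged sig S C Δ₂) : Arranged sig S C (Δ₁ ++ Δ₂) := by
  intro l hl
  rcases List.mem_append.1 hl with hl | hl
  · refine ⟨(h₁ l hl).1, fun x hx hS => ?_⟩
    obtain ⟨c, hc, h⟩ := (h₁ l hl).2 x hx hS
    exact ⟨c, hc, List.mem_append_left _ h⟩
  · refine ⟨(h₂ l hl).1, fun x hx hS => ?_⟩
    obtain ⟨c, hc, h⟩ := (h₂ l hl).2 x hx hS
    exact ⟨c, hc, List.mem_append_right _ h⟩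

/-- The required equation is sought in `l :: Δ` and not in `Δ`, since a literal `x = c` provides the
equation for its own variable. -/
theorem Arranged.cons {Δ : List Literal} (h : Arranged sig S C Δ) {l : Literal} {L : Side}
    (hl : l.1.In (sig L))
    (hv : ∀ x ∈ l.1.vars, Var.sort x = S → ∃ c ∈ C, (Atom.eqConst x c, true) ∈ l :: Δ) :
    Arranged sig S C (l :: Δ) := by
  intro k hk
  rcases List.mem_cons.1 hk with rfl | hk
  · exact ⟨⟨L, hl⟩, hv⟩
  · refine ⟨(h k hk).1, fun x hx hS => ?_⟩
    obtain ⟨c, hc, h⟩ := (h k hk).2 x hx hS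
    exact ⟨c, hc, List.mem_cons_of_mem _ h⟩

theorem Arranged.flatten {n : ℕ} {Δs : Fin n → List Literal}
    (h : ∀ i, Arranged sig S C (Δs i)) : Arranged sig S C (List.ofFn Δs).reverse.flatten := by
  intro l hl
  obtain ⟨i, hi⟩ := mem_flatten_reverse_ofFn.1 hl
  refine ⟨(h i l hi).1, fun x hx hS => ?_⟩
  obtain ⟨c, hc, h⟩ := (h i l hi).2 x hx hS
  exact ⟨c, hc, mem_flatten_reverse_ofFn.2 ⟨i, h⟩⟩

/-- The term `u` is pure, has no shared variables, and is equal to `t` under the assumptions `Δ`. -/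
structure IsFlat (sig : Side → Signature) (S : ℕ) {s : ℕ} (t u : Term s) (Δ : List Literal) :
    Prop where
  pure : ∀ L, s ∈ (sig L).sorts → u.In (sig L)
  sort_ne : ∀ x ∈ u.vars, Var.sort x ≠ S
  eval_eq : ∀ (M : Struc) (v : M.Val), (∀ l ∈ Δ, Literal.Holds M v l) → u.eval M v = t.eval M v

theorem side_eq (hsh : (sig .wf).inter (sig .pm) = edtSignature S C) {s : ℕ} {L K : Side}
    (hL : s ∈ (sig L).sorts) (hK : s ∈ (sig K).sorts) (hs : s ≠ S) : L = K := by
  cases L <;> cases K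
  · rfl
  · exact absurd (sort_eq_of_mem hsh hL hK) hs
  · exact absurd (sort_eq_of_mem hsh hK hL) hs
  · rfl

/-- A guessed constant belongs to both signatures and has no variables. A term of another sort is
kept, and its sort determines its side. By `hv`, a variable of sort `S` can occur only if the
recorded equation is itself of the form `x = c`; this is phrased with atoms to avoid casts between
sorts. -/
theorem Flatten.spec (hsh : (sig .wf).inter (sig .pm) = edtSignature S C) {s : ℕ}
    {t u' u : Term s} {Δ₀ Δ : List Literal} (h : Flatten S C u' Δ₀ u Δ) {K : Side}
    (hu' : u'.In (sig K))
    (hv : ∀ x ∈ u'.vars, Var.sort x = S → s = S ∧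
      ∀ c, Atom.equal u' (Term.const s c) = Atom.eqConst x c)
    (heval : ∀ (M : Struc) (v : M.Val), (∀ l ∈ Δ₀, Literal.Holds M v l) →
      u'.eval M v = t.eval M v) (hΔ₀ : Arranged sig S C Δ₀) :
    Arranged sig S C Δ ∧ IsFlat sig S t u Δ := by
  unfold Flatten at h
  split_ifs at h with hs
  · subst hs
    obtain ⟨c, hc, rfl, rfl⟩ := h
    refine ⟨hΔ₀.cons (L := K) ⟨hu', Term.in_const (const_mem_side hsh hc K)⟩ fun x hx hxs => ?_,
      fun L _ => Term.in_const (const_mem_side hsh hc L), by simp [Term.vars_const],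
      fun M v hM => ?_⟩
    · rw [Atom.vars, Term.vars_const, List.append_nil] at hx
      refine ⟨c, hc, ?_⟩
      rw [(hv x hx hxs).2 c]
      exact List.mem_cons_self ..
    · rw [← heval M v fun l hl => hM l (List.mem_cons_of_mem _ hl)]
      exact ((Literal.holds_mk.1 (hM _ (List.mem_cons_self ..))).1 rfl).symm
  · obtain ⟨rfl, rfl⟩ := h
    refine ⟨hΔ₀, fun L hL => ?_, fun x hx hxs => hs (hv x hx hxs).1, heval⟩
    rwa [side_eq hsh hL (Term.sort_mem hu') hs]

theorem exists_side_of_mem_funs {f : FunSym} (h : f ∈ (wholeSig sig).funs) :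
    ∃ L, f ∈ (sig L).funs :=
  h.elim (fun h => ⟨.wf, h⟩) (fun h => ⟨.pm, h⟩)

theorem Term.Out.spec (hsh : (sig .wf).inter (sig .pm) = edtSignature S C) {s : ℕ} {t u : Term s}
    {Δ : List Literal} (ht : t.In (wholeSig sig)) (h : t.Out S C u Δ) :
    Arranged sig S C Δ ∧ IsFlat sig S t u Δ := by
  induction t generalizing Δ with
  | var x =>
    rw [Term.In] at ht
    obtain ⟨L, hL⟩ : ∃ L, x.2 ∈ (sig L).sorts :=
      ht.elim (fun h => ⟨.wf, h⟩) (fun h => ⟨.pm, h⟩)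
    refine Flatten.spec hsh h (K := L) (by rwa [Term.In]) (fun y hy hyS => ?_)
      (fun _ _ _ => rfl) (fun l hl => absurd hl List.not_mem_nil)
    rw [Term.vars, List.mem_singleton] at hy
    subst hy
    exact ⟨hyS, fun c => rfl⟩
  | app f ts ih =>
    rw [Term.In] at ht
    obtain ⟨us, Δs, hus, h⟩ := h
    obtain ⟨L, hL⟩ := exists_side_of_mem_funs ht.1
    have hsp := fun i => ih i (ht.2 i) (hus i)
    refine Flatten.spec hsh h (K := L) ?_ (fun y hy hyS => ?_) (fun M v hM => ?_)
      (Arranged.flatten fun i => (hsp i).1)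
    · rw [Term.In]
      -- Flattened arguments are over every side that owns their sort, in particular over the side
      -- of the head symbol.
      exact ⟨hL, fun i => (hsp i).2.pure L ((sig L).dom_mem f hL _ (List.get_mem _ _))⟩
    · obtain ⟨i, hi⟩ := Term.mem_vars_app.1 hy
      exact absurd hyS ((hsp i).2.sort_ne y hi)
    · rw [Term.eval, Term.eval]
      congr 1
      funext i
      exact (hsp i).2.eval_eq M v fun l hl => hM l (mem_flatten_reverse_ofFn.2 ⟨i, hl⟩)

theorem Atom.Out.spec (hsh : (sig .wf).inter (sig .pm) = edtSignature S C) {α : Atom} {b : Bool}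
    {Δ : List Literal} (hα : α.In (wholeSig sig)) (h : α.Out S C b Δ) :
    Arranged sig S C Δ ∧ ∀ (M : Struc) (v : M.Val), (∀ l ∈ Δ, Literal.Holds M v l) →
      (b = true ↔ α.Holds M v) := by
  cases α with
  | @equal s t u =>
    obtain ⟨t', u', Δ₁, Δ₂, ht, hu, rfl⟩ := h
    obtain ⟨ht₁, ht₂⟩ := ht.spec hsh hα.1
    obtain ⟨hu₁, hu₂⟩ := hu.spec hsh hα.2
    obtain ⟨L, hL⟩ : ∃ L, s ∈ (sig L).sorts :=
      (Term.sort_mem hα.1).elim (fun h => ⟨.wf, h⟩) (fun h => ⟨.pm, h⟩)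
    refine ⟨(hu₁.append ht₁).cons (L := L) ⟨ht₂.pure L hL, hu₂.pure L hL⟩ fun x hx hxS => ?_,
      fun M v hM => ?_⟩
    · rw [Atom.vars, List.mem_append] at hx
      exact absurd hxS (hx.elim (ht₂.sort_ne x) (hu₂.sort_ne x))
    · rw [Literal.holds_mk.1 (hM _ (List.mem_cons_self ..)), Atom.Holds, Atom.Holds,
        ht₂.eval_eq M v fun l hl => hM l (by simp [hl]),
        hu₂.eval_eq M v fun l hl => hM l (by simp [hl])]
  | rel r ts =>
    obtain ⟨us, Δs, hus, rfl⟩ := h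
    have hsp := fun i => (hus i).spec hsh (hα.2 i)
    obtain ⟨L, hL⟩ : ∃ L, r ∈ (sig L).rels :=
      hα.1.elim (fun h => ⟨.wf, h⟩) (fun h => ⟨.pm, h⟩)
    refine ⟨(Arranged.flatten fun i => (hsp i).1).cons (L := L)
      ⟨hL, fun i => (hsp i).2.pure L ((sig L).rel_mem r hL _ (List.get_mem _ _))⟩
      fun x hx hxS => ?_, fun M v hM => ?_⟩
    · obtain ⟨i, hi⟩ := Atom.mem_vars_rel.1 hx
      exact absurd hxS ((hsp i).2.sort_ne x hi)
    · have : (fun i => (us i).eval M v) = fun i => (ts i).eval M v := by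
        funext i
        exact (hsp i).2.eval_eq M v fun l hl =>
          hM l (List.mem_cons_of_mem _ (mem_flatten_reverse_ofFn.2 ⟨i, hl⟩))
      rw [Literal.holds_mk.1 (hM _ (List.mem_cons_self ..)), Atom.Holds, Atom.Holds, this]

theorem QF.Out.spec (hsh : (sig .wf).inter (sig .pm) = edtSignature S C) {φ : QF} {b : Bool}
    {Δ : List Literal} (hφ : φ.In (wholeSig sig)) (h : φ.Out S C b Δ) :
    Arranged sig S C Δ ∧ ∀ (M : Struc) (v : M.Val), (∀ l ∈ Δ, Literal.Holds M v l) →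
      (b = true ↔ φ.Holds M v) := by
  induction φ generalizing b Δ with
  | tru =>
    obtain ⟨rfl, rfl⟩ := h
    exact ⟨fun l hl => absurd hl List.not_mem_nil, fun _ _ _ => by simp [QF.Holds]⟩
  | atom α => exact Atom.Out.spec hsh hφ h
  | not φ ih =>
    obtain ⟨b', h, rfl⟩ := h
    obtain ⟨h₁, h₂⟩ := ih hφ h
    refine ⟨h₁, fun M v hM => ?_⟩
    rw [QF.Holds, ← h₂ M v hM]
    simp
  | and φ ψ ih ih' =>
    obtain ⟨b₁, b₂, Δ₁, Δ₂, h₁, h₂, rfl, rfl⟩ := h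
    obtain ⟨h₁, h₁'⟩ := ih hφ.1 h₁
    obtain ⟨h₂, h₂'⟩ := ih' hφ.2 h₂
    refine ⟨h₂.append h₁, fun M v hM => ?_⟩
    rw [QF.Holds, ← h₁' M v fun l hl => hM l (List.mem_append_right _ hl),
      ← h₂' M v fun l hl => hM l (List.mem_append_left _ hl)]
    simp
  | or φ ψ ih ih' =>
    obtain ⟨b₁, b₂, Δ₁, Δ₂, h₁, h₂, rfl, rfl⟩ := h
    obtain ⟨h₁, h₁'⟩ := ih hφ.1 h₁
    obtain ⟨h₂, h₂'⟩ := ih' hφ.2 h₂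
    refine ⟨h₂.append h₁, fun M v hM => ?_⟩
    rw [QF.Holds, ← h₁' M v fun l hl => hM l (List.mem_append_right _ hl),
      ← h₂' M v fun l hl => hM l (List.mem_append_left _ hl)]
    simp

/-- The structure itself makes the guess: the constant that denotes the value of `u'`. -/
theorem exists_flatten {M : Struc} (hM : ∀ d : M.carrier S, ∃ c ∈ C, d = M.const S c) (v : M.Val)
    {s : ℕ} (u' : Term s) {Δ₀ : List Literal} (hΔ₀ : ∀ l ∈ Δ₀, Literal.Holds M v l) :
    ∃ u Δ, Flatten S C u' Δ₀ u Δ ∧ ∀ l ∈ Δ, Literal.Holds M v l := by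
  unfold Flatten
  split_ifs with hs
  · subst hs
    obtain ⟨c, hc, h⟩ := hM (u'.eval M v)
    refine ⟨_, _, ⟨c, hc, rfl, rfl⟩, List.forall_mem_cons.2 ⟨Literal.holds_mk.2 ?_, hΔ₀⟩⟩
    rw [Atom.Holds, Term.eval_const]
    simp [h]
  · exact ⟨_, _, ⟨rfl, rfl⟩, hΔ₀⟩

theorem Term.exists_out {M : Struc} (hM : ∀ d : M.carrier S, ∃ c ∈ C, d = M.const S c) (v : M.Val)
    {s : ℕ} (t : Term s) : ∃ u Δ, t.Out S C u Δ ∧ ∀ l ∈ Δ, Literal.Holds M v l := by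
  induction t with
  | var x => exact exists_flatten hM v _ (by simp)
  | app f ts ih =>
    choose us Δs hus hΔs using ih
    obtain ⟨u, Δ, h, hΔ⟩ := exists_flatten hM v (.app f us)
      (Δ₀ := (List.ofFn Δs).reverse.flatten) fun l hl => by
        obtain ⟨i, hi⟩ := mem_flatten_reverse_ofFn.1 hl
        exact hΔs i l hi
    exact ⟨u, Δ, ⟨us, Δs, hus, h⟩, hΔ⟩

theorem Atom.exists_out {M : Struc} (hM : ∀ d : M.carrier S, ∃ c ∈ C, d = M.const S c) (v : M.Val)
    (α : Atom) : ∃ b Δ, α.Out S C b Δ ∧ ∀ l ∈ Δ, Literal.Holds M v l := by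
  classical
  cases α with
  | equal t u =>
    obtain ⟨t', Δ₁, ht, h₁⟩ := t.exists_out hM v
    obtain ⟨u', Δ₂, hu, h₂⟩ := u.exists_out hM v
    refine ⟨decide ((Atom.equal t' u').Holds M v), _, ⟨t', u', Δ₁, Δ₂, ht, hu, rfl⟩,
      List.forall_mem_cons.2 ⟨Literal.holds_mk.2 (by simp), fun l hl => ?_⟩⟩
    exact (List.mem_append.1 hl).elim (h₂ l) (h₁ l)
  | rel r ts =>
    choose us Δs hus hΔs using fun i => (ts i).exists_out hM v
    refine ⟨decide ((Atom.rel r us).Holds M v), _, ⟨us, Δs, hus, rfl⟩,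
      List.forall_mem_cons.2 ⟨Literal.holds_mk.2 (by simp), fun l hl => ?_⟩⟩
    obtain ⟨i, hi⟩ := mem_flatten_reverse_ofFn.1 hl
    exact hΔs i l hi

theorem QF.exists_out {M : Struc} (hM : ∀ d : M.carrier S, ∃ c ∈ C, d = M.const S c) (v : M.Val)
    (φ : QF) : ∃ b Δ, φ.Out S C b Δ ∧ ∀ l ∈ Δ, Literal.Holds M v l := by
  induction φ with
  | tru => exact ⟨true, [], ⟨rfl, rfl⟩, by simp⟩
  | atom α => exact α.exists_out hM v
  | not φ ih =>
    obtain ⟨b, Δ, h, hΔ⟩ := ih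
    exact ⟨_, Δ, ⟨b, h, rfl⟩, hΔ⟩
  | and φ ψ ih ih' =>
    obtain ⟨b₁, Δ₁, h₁, hΔ₁⟩ := ih
    obtain ⟨b₂, Δ₂, h₂, hΔ₂⟩ := ih'
    exact ⟨_, _, ⟨b₁, b₂, Δ₁, Δ₂, h₁, h₂, rfl, rfl⟩,
      fun l hl => (List.mem_append.1 hl).elim (hΔ₂ l) (hΔ₁ l)⟩
  | or φ ψ ih ih' =>
    obtain ⟨b₁, Δ₁, h₁, hΔ₁⟩ := ih
    obtain ⟨b₂, Δ₂, h₂, hΔ₂⟩ := ih'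
    exact ⟨_, _, ⟨b₁, b₂, Δ₁, Δ₂, h₁, h₂, rfl, rfl⟩,
      fun l hl => (List.mem_append.1 hl).elim (hΔ₂ l) (hΔ₁ l)⟩

/-- Satisfiability in the union of the theories in terms of the outcomes and the solvers. -/
theorem satQF_iff_exists_out (hsh : (sig .wf).inter (sig .pm) = edtSignature S C)
    {T : Side → Set Formula} {solve : Side → Solver}
    (hT : ∀ L, IsTheory (sig L) (T L)) (hE : ∀ L, EDT S C ⊆ T L)
    (hsound : ∀ L, (solve L).Sound (sig L) (T L))
    (hsat : ∀ L Γ, (∀ l ∈ Γ, l.1.In (sig L)) → solve L Γ = none → SatLits (T L) Γ)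
    {φ : QF} (hφ : φ.In (wholeSig sig)) (filt : Side → List Literal → List Literal)
    (hfilt : ∀ L Δ l, l ∈ filt L Δ ↔ l ∈ Δ ∧ l.1.In (sig L)) :
    SatQF (T .wf ∪ T .pm) φ ↔ ∃ Δ, φ.Out S C true Δ ∧ ∀ L, solve L (filt L Δ) = none := by
  constructor
  · rintro ⟨M, hM, v, hv⟩
    have hMs : ∀ L, M.Models (T L)
      | .wf => fun ψ hψ => hM ψ (Or.inl hψ)
      | .pm => fun ψ hψ => hM ψ (Or.inr hψ)
    -- The guesses follow `M` and `v`, so all assumptions hold there. A solver answering "unsat"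
    -- would exhibit an unsatisfiable subset of them.
    obtain ⟨b, Δ, h, hΔ⟩ := φ.exists_out ((hMs .wf).exists_const (hE .wf)) v
    obtain rfl : b = true := ((h.spec hsh hφ).2 M v hΔ).2 hv
    refine ⟨Δ, h, fun L => ?_⟩
    by_contra hne
    obtain ⟨π, hπ⟩ := Option.ne_none_iff_exists'.1 hne
    obtain ⟨h₁, h₂⟩ := hsound L _ π (fun l hl => ((hfilt L Δ l).1 hl).2) hπ
    exact h₂ ⟨M, hMs L, v, fun l hl => hΔ l ((hfilt L Δ l).1 (h₁ l hl)).1⟩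
  · rintro ⟨Δ, h, hs⟩
    obtain ⟨harr, hΔ⟩ := h.spec hsh hφ
    have hS := fun L => hsat L _ (fun l hl => ((hfilt L Δ l).1 hl).2) (hs L)
    obtain ⟨M₁, hM₁, v₁, h₁⟩ := hS .wf
    obtain ⟨M₂, hM₂, v₂, h₂⟩ := hS .pm
    -- The assumptions are pure and arranged, so the models of their two parts combine; by `hΔ` the
    -- assumptions then force `φ` to be true.
    obtain ⟨M, hM, v, hv⟩ := exists_combined hsh (hT .wf) (hT .pm) (hE .wf) (hE .pm)
      (Γ := {l | l ∈ Δ}) (fun l hl => by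
        obtain ⟨_ | _, hL⟩ := (harr l hl).1
        · exact Or.inl hL
        · exact Or.inr hL)
      (fun l hl => (harr l hl).2) hM₁ hM₂
      (fun l hl hA => h₁ l ((hfilt .wf Δ l).2 ⟨hl, hA⟩))
      (fun l hl hA => h₂ l ((hfilt .pm Δ l).2 ⟨hl, hA⟩))
    exact ⟨M, hM, v, (hΔ M v hv).1 rfl⟩

end Outcomes

/-! A nondeterministic stack machine that computes the outcomes. -/

/-- A state of the machine: a stack of words of terms, a stack of truth values, and the words of the
assumptions. -/
abbrev MState := List (List Token) × List Bool × List (List Token × Bool)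

/-- Pop `n` words from a stack and append them. -/
def popWords (n : ℕ) (ts : List (List Token)) : List Token × List (List Token) :=
  (fun p : List Token × List (List Token) => (p.2.headI ++ p.1, p.2.tail))^[n] ([], ts)

/-- Push a term of sort `s`, or a guessed constant if `s` is the substrate sort. -/
def pushTerm (S : ℕ) (C : List ℕ) (s : ℕ) (w : List Token) (st : MState) : List MState :=
  if s = S then C.map fun c =>
    ([Token.fn (constSym s c)] :: st.1, st.2.1,
      (w ++ [Token.fn (constSym s c)] ++ [Token.logic 0], true) :: st.2.2)
  else [(w :: st.1, st.2)]

/-- Push a guessed truth value of an atom. -/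
def pushAtom (w : List Token) (st : MState) : List MState :=
  [true, false].map fun b => (st.1, b :: st.2.1, (w, b) :: st.2.2)

/-- The effect of a logical symbol. -/
def logicMoves (st : MState) (n : ℕ) : List MState :=
  if n = 0 then pushAtom ((popWords 2 st.1).1 ++ [Token.logic 0]) ((popWords 2 st.1).2, st.2)
  else if n = 1 then [(st.1, true :: st.2.1, st.2.2)]
  else if n = 2 then [(st.1, (!st.2.1.headI) :: st.2.1.tail, st.2.2)]
  else if n = 3 then
    [(st.1, (st.2.1.tail.headI && st.2.1.headI) :: st.2.1.tail.tail, st.2.2)]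
  else [(st.1, (st.2.1.tail.headI || st.2.1.headI) :: st.2.1.tail.tail, st.2.2)]

/-- The possible successors of a state when a token is read. -/
def moves (S : ℕ) (C : List ℕ) (st : MState) (tok : Token) : List MState :=
  Sum.casesOn tok (fun x => pushTerm S C (Var.sort x) [Token.var x] st) fun tok =>
    Sum.casesOn tok (fun f => pushTerm S C (FunSym.cod f)
      ((popWords (FunSym.dom f).length st.1).1 ++ [Token.fn f])
      ((popWords (FunSym.dom f).length st.1).2, st.2)) fun tok =>
    Sum.casesOn tok (fun r => pushAtom
      ((popWords (RelSym.dom r).length st.1).1 ++ [Token.rel r])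
      ((popWords (RelSym.dom r).length st.1).2, st.2)) fun n => logicMoves st n

/-- The possible states after a word has been read. -/
def runWord (S : ℕ) (C : List ℕ) (w : List Token) (sts : List MState) : List MState :=
  w.foldl (fun sts tok => sts.flatMap fun st => moves S C st tok) sts

section Machine

variable {S : ℕ} {C : List ℕ}

/-- The branches of the nondeterministic run do not interact, so it suffices to study a single
initial state. -/
theorem mem_runWord {w : List Token} {sts : List MState} {st' : MState} :
    st' ∈ runWord S C w sts ↔ ∃ st ∈ sts, st' ∈ runWord S C w [st] := by
  induction w generalizing sts with
  | nil => simp [runWord]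
  | cons tok w ih =>
    change st' ∈ runWord S C w _ ↔ ∃ st ∈ sts, st' ∈ runWord S C w _
    rw [ih]
    have := fun st => ih (sts := [st].flatMap fun st => moves S C st tok)
    simp only [this, List.mem_flatMap, List.mem_singleton]
    constructor
    · rintro ⟨a, ⟨b, hb, ha⟩, h⟩
      exact ⟨b, hb, a, ⟨b, rfl, ha⟩, h⟩
    · rintro ⟨b, hb, a, ⟨_, rfl, ha⟩, h⟩
      exact ⟨a, ⟨_, hb, ha⟩, h⟩

theorem mem_runWord_append {w w' : List Token} {st st' : MState} :
    st' ∈ runWord S C (w ++ w') [st] ↔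
      ∃ st₁ ∈ runWord S C w [st], st' ∈ runWord S C w' [st₁] := by
  rw [← mem_runWord, runWord, List.foldl_append]
  rfl

theorem runWord_singleton {tok : Token} {st : MState} :
    runWord S C [tok] [st] = moves S C st tok := by
  simp [runWord]

/-- The last argument is on top of the stack. Popping prepends each word to those already popped,
which restores the original order; hence the induction from the right. -/
theorem popWords_aux (cs : List (List Token)) (a : List Token) (ts : List (List Token)) :
    (fun p : List Token × List (List Token) => (p.2.headI ++ p.1, p.2.tail))^[cs.length]
      (a, cs.reverse ++ ts) = (cs.flatten ++ a, ts) := by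
  induction cs using List.reverseRecOn generalizing a with
  | nil => simp
  | append_singleton cs c ih =>
    rw [List.length_append, List.length_singleton, Function.iterate_succ_apply]
    simp [ih]

theorem popWords_reverse (cs : List (List Token)) (ts : List (List Token)) {n : ℕ}
    (hn : cs.length = n) : popWords n (cs.reverse ++ ts) = (cs.flatten, ts) := by
  subst hn
  simpa [popWords] using popWords_aux cs [] ts

theorem Term.code_const {s c : ℕ} : (Term.const s c).code = [Token.fn (constSym s c)] := by
  rw [Term.const, Term.code]
  rfl

theorem mem_pushTerm {s : ℕ} {u' : Term s} {Δ₀ : List Literal} {ts : List (List Token)}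
    {bs : List Bool} {K : List (List Token × Bool)} {st' : MState} :
    st' ∈ pushTerm S C s u'.code (ts, bs, Δ₀.map Literal.code ++ K) ↔
      ∃ u Δ, Flatten S C u' Δ₀ u Δ ∧ st' = (u.code :: ts, bs, Δ.map Literal.code ++ K) := by
  unfold pushTerm Flatten
  split_ifs with hs
  · rw [List.mem_map]
    constructor
    · rintro ⟨c, hc, rfl⟩
      refine ⟨_, _, ⟨c, hc, rfl, rfl⟩, ?_⟩
      simp [Term.code_const, Literal.code, Atom.code]
    · rintro ⟨_, _, ⟨c, hc, rfl, rfl⟩, rfl⟩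
      refine ⟨c, hc, ?_⟩
      simp [Term.code_const, Literal.code, Atom.code]
  · simp

theorem mem_pushAtom {α : Bool → Atom} {w : List Token} (hα : ∀ b, (α b).code = w)
    {Δ : List Literal} {ts : List (List Token)} {bs : List Bool} {K : List (List Token × Bool)}
    {st' : MState} :
    st' ∈ pushAtom w (ts, bs, Δ.map Literal.code ++ K) ↔
      ∃ b, st' = (ts, b :: bs, ((α b, b) :: Δ).map Literal.code ++ K) := by
  simp [pushAtom, Literal.code, hα, or_comm]

/-- The machine computes the outcomes of a sequence of terms if it does so for each term. -/
theorem mem_runWord_flatten {n : ℕ} {s : Fin n → ℕ} {ts : ∀ i, Term (s i)}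
    (h : ∀ i (st st' : MState), st' ∈ runWord S C (ts i).code [st] ↔
      ∃ u Δ, (ts i).Out S C u Δ ∧ st' = (u.code :: st.1, st.2.1, Δ.map Literal.code ++ st.2.2))
    {st st' : MState} :
    st' ∈ runWord S C (List.ofFn fun i => (ts i).code).flatten [st] ↔
      ∃ (us : ∀ i, Term (s i)) (Δs : Fin n → List Literal), (∀ i, (ts i).Out S C (us i) (Δs i)) ∧
        st' = ((List.ofFn fun i => (us i).code).reverse ++ st.1, st.2.1,
          (List.ofFn Δs).reverse.flatten.map Literal.code ++ st.2.2) := by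
  induction n generalizing st with
  | zero =>
    simp only [List.ofFn_zero, List.flatten_nil, List.reverse_nil, List.nil_append, List.map_nil,
      runWord, List.foldl_nil, List.mem_singleton]
    exact ⟨fun h => ⟨fun i => i.elim0, fun i => i.elim0, fun i => i.elim0, h⟩,
      fun ⟨_, _, _, h⟩ => h⟩
  | succ n ih =>
    -- The first term is read first, so its word and its assumptions end up below those of the later
    -- terms; hence the reversed lists.
    rw [List.ofFn_succ, List.flatten_cons, mem_runWord_append]
    constructor
    · rintro ⟨st₁, h₁, h₂⟩
      obtain ⟨u, Δ, hu, rfl⟩ := (h 0 _ _).1 h₁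
      obtain ⟨us, Δs, hus, rfl⟩ := (ih fun i => h i.succ).1 h₂
      refine ⟨Fin.cons (α := fun i => Term (s i)) u us,
        Fin.cons (α := fun _ => List Literal) Δ Δs, Fin.cases hu hus, ?_⟩
      simp [List.ofFn_succ]
    · rintro ⟨us, Δs, hus, rfl⟩
      refine ⟨_, (h 0 _ _).2 ⟨us 0, Δs 0, hus 0, rfl⟩, (ih fun i => h i.succ).2
        ⟨fun i => us i.succ, fun i => Δs i.succ, fun i => hus i.succ, ?_⟩⟩
      simp [List.ofFn_succ]

/-- Reading a complete term amounts to one push, whatever the stacks contain. The statement for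
arbitrary initial states is what the induction needs. -/
theorem Term.mem_runWord {s : ℕ} (t : Term s) (st st' : MState) :
    st' ∈ runWord S C t.code [st] ↔
      ∃ u Δ, t.Out S C u Δ ∧ st' = (u.code :: st.1, st.2.1, Δ.map Literal.code ++ st.2.2) := by
  induction t generalizing st st' with
  | var x =>
    rw [Term.code, runWord_singleton]
    exact mem_pushTerm (u' := .var x) (Δ₀ := [])
  | app f ts ih =>
    rw [Term.code, mem_runWord_append]
    simp only [mem_runWord_flatten ih, runWord_singleton]
    -- When the head symbol is read, the words of the flattened arguments lie reversed on the stack;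
    -- popping them and appending the symbol gives the word of `Term.app f us`.
    have key : ∀ (us : ∀ i : Fin (FunSym.dom f).length, Term ((FunSym.dom f).get i))
        (Δ₀ : List Literal), st' ∈ moves S C
          ((List.ofFn fun i => (us i).code).reverse ++ st.1, st.2.1,
            Δ₀.map Literal.code ++ st.2.2) (Token.fn f) ↔
        ∃ u Δ, Flatten S C (.app f us) Δ₀ u Δ ∧
          st' = (u.code :: st.1, st.2.1, Δ.map Literal.code ++ st.2.2) := by
      intro us Δ₀
      rw [← mem_pushTerm]
      dsimp only [moves]
      rw [popWords_reverse _ _ (List.length_ofFn), Term.code]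
    constructor
    · rintro ⟨_, ⟨us, Δs, hus, rfl⟩, h⟩
      obtain ⟨u, Δ, hu, rfl⟩ := (key us _).1 h
      exact ⟨u, Δ, ⟨us, Δs, hus, hu⟩, rfl⟩
    · rintro ⟨u, Δ, ⟨us, Δs, hus, hu⟩, h⟩
      exact ⟨_, ⟨us, Δs, hus, rfl⟩, (key us _).2 ⟨u, Δ, hu, h⟩⟩

theorem Atom.mem_runWord (α : Atom) (st st' : MState) :
    st' ∈ runWord S C α.code [st] ↔
      ∃ b Δ, α.Out S C b Δ ∧ st' = (st.1, b :: st.2.1, Δ.map Literal.code ++ st.2.2) := by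
  cases α with
  | @equal s t u =>
    rw [Atom.code, mem_runWord_append]
    simp only [mem_runWord_append, Term.mem_runWord, runWord_singleton]
    have key : ∀ (t' u' : Term s) (Δ : List Literal), st' ∈ moves S C
          (u'.code :: t'.code :: st.1, st.2.1, Δ.map Literal.code ++ st.2.2) (Token.logic 0) ↔
        ∃ b, st' = (st.1, b :: st.2.1,
          ((Atom.equal t' u', b) :: Δ).map Literal.code ++ st.2.2) := by
      intro t' u' Δ
      rw [← mem_pushAtom (α := fun _ => Atom.equal t' u') fun _ => rfl]
      have := popWords_reverse [t'.code, u'.code] st.1 rfl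
      simp only [List.reverse_cons, List.reverse_nil, List.nil_append, List.cons_append,
        List.length_cons, List.length_nil, Nat.reduceAdd, List.flatten_cons, List.flatten_nil,
        List.append_nil] at this
      dsimp only [moves, logicMoves]
      rw [if_pos rfl, this, Atom.code]
    constructor
    · rintro ⟨_, ⟨_, ⟨t', Δ₁, ht, rfl⟩, u', Δ₂, hu, rfl⟩, h⟩
      dsimp only at h
      rw [← List.append_assoc, ← List.map_append] at h
      obtain ⟨b, rfl⟩ := (key t' u' _).1 h
      exact ⟨b, _, ⟨t', u', Δ₁, Δ₂, ht, hu, rfl⟩, rfl⟩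
    · rintro ⟨b, Δ, ⟨t', u', Δ₁, Δ₂, ht, hu, rfl⟩, h⟩
      refine ⟨_, ⟨_, ⟨t', Δ₁, ht, rfl⟩, u', Δ₂, hu, rfl⟩, ?_⟩
      dsimp only
      rw [← List.append_assoc, ← List.map_append]
      exact (key t' u' _).2 ⟨b, h⟩
  | rel r ts =>
    rw [Atom.code, mem_runWord_append]
    simp only [mem_runWord_flatten fun i => (ts i).mem_runWord, runWord_singleton]
    have key : ∀ (us : ∀ i : Fin (RelSym.dom r).length, Term ((RelSym.dom r).get i))
        (Δ : List Literal), st' ∈ moves S C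
          ((List.ofFn fun i => (us i).code).reverse ++ st.1, st.2.1,
            Δ.map Literal.code ++ st.2.2) (Token.rel r) ↔
        ∃ b, st' = (st.1, b :: st.2.1, ((Atom.rel r us, b) :: Δ).map Literal.code ++ st.2.2) := by
      intro us Δ
      rw [← mem_pushAtom (α := fun _ => Atom.rel r us) fun _ => rfl]
      dsimp only [moves]
      rw [popWords_reverse _ _ (List.length_ofFn), Atom.code]
    constructor
    · rintro ⟨_, ⟨us, Δs, hus, rfl⟩, h⟩
      obtain ⟨b, rfl⟩ := (key us _).1 h
      exact ⟨b, _, ⟨us, Δs, hus, rfl⟩, rfl⟩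
    · rintro ⟨b, Δ, ⟨us, Δs, hus, rfl⟩, h⟩
      exact ⟨_, ⟨us, Δs, hus, rfl⟩, (key us _).2 ⟨b, h⟩⟩

/-- The value of the second operand is on top of the stack, and its assumptions come before those of
the first. Logical symbols act deterministically; all branching is in terms and atoms. -/
theorem QF.mem_runWord (φ : QF) (st st' : MState) :
    st' ∈ runWord S C φ.code [st] ↔
      ∃ b Δ, φ.Out S C b Δ ∧ st' = (st.1, b :: st.2.1, Δ.map Literal.code ++ st.2.2) := by
  induction φ generalizing st st' with
  | tru =>
    rw [QF.code, runWord_singleton]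
    constructor
    · intro h
      obtain rfl := List.mem_singleton.1 h
      exact ⟨true, [], ⟨rfl, rfl⟩, rfl⟩
    · rintro ⟨_, _, ⟨rfl, rfl⟩, rfl⟩
      exact List.mem_singleton.2 rfl
  | atom α => exact α.mem_runWord st st'
  | not φ ih =>
    rw [QF.code, mem_runWord_append]
    simp only [ih, runWord_singleton]
    constructor
    · rintro ⟨_, ⟨b, Δ, h, rfl⟩, h'⟩
      obtain rfl := List.mem_singleton.1 h'
      exact ⟨!b, Δ, ⟨b, h, rfl⟩, rfl⟩
    · rintro ⟨_, Δ, ⟨b, h, rfl⟩, rfl⟩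
      exact ⟨_, ⟨b, Δ, h, rfl⟩, List.mem_singleton.2 rfl⟩
  | and φ ψ ih ih' =>
    rw [QF.code, mem_runWord_append]
    simp only [mem_runWord_append, ih, ih', runWord_singleton]
    constructor
    · rintro ⟨_, ⟨_, ⟨b₁, Δ₁, h₁, rfl⟩, b₂, Δ₂, h₂, rfl⟩, h'⟩
      obtain rfl := List.mem_singleton.1 h'
      exact ⟨_, _, ⟨b₁, b₂, Δ₁, Δ₂, h₁, h₂, rfl, rfl⟩, by simp⟩
    · rintro ⟨_, _, ⟨b₁, b₂, Δ₁, Δ₂, h₁, h₂, rfl, rfl⟩, rfl⟩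
      exact ⟨_, ⟨_, ⟨b₁, Δ₁, h₁, rfl⟩, b₂, Δ₂, h₂, rfl⟩, List.mem_singleton.2 (by simp)⟩
  | or φ ψ ih ih' =>
    rw [QF.code, mem_runWord_append]
    simp only [mem_runWord_append, ih, ih', runWord_singleton]
    constructor
    · rintro ⟨_, ⟨_, ⟨b₁, Δ₁, h₁, rfl⟩, b₂, Δ₂, h₂, rfl⟩, h'⟩
      obtain rfl := List.mem_singleton.1 h'
      exact ⟨_, _, ⟨b₁, b₂, Δ₁, Δ₂, h₁, h₂, rfl, rfl⟩, by simp⟩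
    · rintro ⟨_, _, ⟨b₁, b₂, Δ₁, Δ₂, h₁, h₂, rfl, rfl⟩, rfl⟩
      exact ⟨_, ⟨_, ⟨b₁, Δ₁, h₁, rfl⟩, b₂, Δ₂, h₂, rfl⟩, List.mem_singleton.2 (by simp)⟩

end Machine

/-! Computability. -/

section Lists

variable {α β σ : Type*} [Primcodable α] [Primcodable β] [Primcodable σ]

/-- The fold is a recursion on the number of elements consumed, fetching the next one by its index.
-/
theorem computable_list_foldl {f : α → List β} {g : α → σ} {h : α → σ × β → σ}
    (hf : Computable f) (hg : Computable g) (hh : Computable₂ h) :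
    Computable fun a => (f a).foldl (fun s b => h a (s, b)) (g a) := by
  have key : Computable fun a => Nat.rec (motive := fun _ => σ) (g a)
      (fun n s => Option.casesOn (f a)[n]? s fun b => h a (s, b)) (f a).length := by
    refine Computable.nat_rec (h := fun a (p : ℕ × σ) =>
      (Option.casesOn (f a)[p.1]? p.2 fun b => h a (p.2, b) : σ))
      (Computable.list_length.comp hf) hg ?_
    refine Computable.option_casesOn (o := fun q : α × ℕ × σ => (f q.1)[q.2.1]?)
      (f := fun q => q.2.2) (g := fun q b => h q.1 (q.2.2, b)) ?_ ?_ ?_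
    · exact Computable.list_getElem?.comp (hf.comp .fst) (Computable.fst.comp .snd)
    · exact Computable.snd.comp .snd
    · exact hh.comp (Computable.fst.comp .fst)
        ((Computable.snd.comp (Computable.snd.comp .fst)).pair .snd)
  refine key.of_eq fun a => ?_
  -- After `n` rounds the state is the fold over the first `n` elements; the default for a missing
  -- index is never used, as `n` stays within the length.
  have : ∀ n ≤ (f a).length, Nat.rec (motive := fun _ => σ) (g a)
      (fun n s => Option.casesOn (f a)[n]? s fun b => h a (s, b)) n =
        ((f a).take n).foldl (fun s b => h a (s, b)) (g a) := by
    intro n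
    induction n with
    | zero => simp
    | succ n ih =>
      intro hn
      have hlt : n < (f a).length := hn
      rw [List.take_add_one, List.foldl_append, ← ih hlt.le]
      simp [hlt]
  rw [this _ le_rfl, List.take_length]

theorem computable_list_all {f : α → List β} {p : β → Bool} (hf : Computable f)
    (hp : Computable p) : Computable fun a => (f a).all p := by
  refine (computable_list_foldl (h := fun _ q => q.1 && p q.2) hf (.const true) ?_).of_eq
    fun a => ?_
  · exact (Primrec.and.to_comp.comp (Computable.fst.comp .snd)
      (hp.comp (Computable.snd.comp .snd)))
  · have : ∀ (l : List β) (b : Bool), l.foldl (fun s x => s && p x) b = (b && l.all p) := by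
      intro l
      induction l with
      | nil => simp
      | cons x l ih => intro b; simp [ih, Bool.and_assoc]
    simp [this]

theorem computable_list_any {f : α → List β} {p : β → Bool} (hf : Computable f)
    (hp : Computable p) : Computable fun a => (f a).any p := by
  refine (Primrec.not.to_comp.comp
    (computable_list_all hf (Primrec.not.to_comp.comp hp))).of_eq fun a => ?_
  simp [List.any_eq_not_all_not]

theorem computable_list_filter {f : α → List β} {p : β → Bool} (hf : Computable f)
    (hp : Computable p) : Computable fun a => (f a).filter p := by
  refine (computable_list_foldl (h := fun _ q => cond (p q.2) (q.1 ++ [q.2]) q.1) hf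
    (.const ([] : List β)) ?_).of_eq fun a => ?_
  · have h₁ : Computable fun q : α × List β × β => q.2.1 := Computable.fst.comp .snd
    have h₂ : Computable fun q : α × List β × β => q.2.2 := Computable.snd.comp .snd
    exact Computable.cond (hp.comp h₂) (Computable.list_concat.comp h₁ h₂) h₁
  · have : ∀ (l acc : List β), l.foldl (fun s x => cond (p x) (s ++ [x]) s) acc =
        acc ++ l.filter p := by
      intro l
      induction l with
      | nil => simp
      | cons x l ih => intro acc; cases h : p x <;> simp [ih, h]
    simp [this]

end Lists

/-- A shortcut for instance search. -/
instance primcodableToken : Primcodable Token := Primcodable.sum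

/-- A shortcut for instance search. -/
instance primcodableMState : Primcodable MState := Primcodable.prod

theorem primrec_popWords {α : Type*} [Primcodable α] {n : α → ℕ} {ts : α → List (List Token)}
    (hn : Primrec n) (hts : Primrec ts) : Primrec fun a => popWords (n a) (ts a) := by
  refine Primrec.nat_iterate hn ((Primrec.const []).pair hts)
    (h := fun _ (p : List Token × List (List Token)) => (p.2.headI ++ p.1, p.2.tail)) ?_
  have h₁ : Primrec fun q : α × List Token × List (List Token) => q.2.1 := Primrec.fst.comp .snd
  have h₂ : Primrec fun q : α × List Token × List (List Token) => q.2.2 := Primrec.snd.comp .snd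
  exact (Primrec.list_append.comp (Primrec.list_headI.comp h₂) h₁).pair
    (Primrec.list_tail.comp h₂)

theorem primrec_token_fn : Primrec Token.fn := Primrec.sumInr.comp Primrec.sumInl

theorem primrec_token_rel : Primrec Token.rel :=
  Primrec.sumInr.comp (Primrec.sumInr.comp Primrec.sumInl)

theorem primrec_pushTerm {α : Type*} [Primcodable α] (S : ℕ) (C : List ℕ) {s : α → ℕ}
    {w : α → List Token} {st : α → MState} (hs : Primrec s) (hw : Primrec w) (hst : Primrec st) :
    Primrec fun a => pushTerm S C (s a) (w a) (st a) := by
  have h₁ : Primrec fun a => (st a).1 := Primrec.fst.comp hst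
  have h₂ : Primrec fun a => (st a).2.1 := Primrec.fst.comp (Primrec.snd.comp hst)
  have h₃ : Primrec fun a => (st a).2.2 := Primrec.snd.comp (Primrec.snd.comp hst)
  refine Primrec.ite (Primrec.eq.comp hs (.const S)) (Primrec.list_map (.const C) ?_)
    (Primrec.list_cons.comp ((Primrec.list_cons.comp hw h₁).pair (Primrec.snd.comp hst))
      (.const []))
  have hc : Primrec fun q : α × ℕ => Token.fn (constSym (s q.1) q.2) :=
    primrec_token_fn.comp (Primrec.snd.pair ((Primrec.const []).pair (hs.comp .fst)))
  have hc' : Primrec fun q : α × ℕ => [Token.fn (constSym (s q.1) q.2)] :=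
    Primrec.list_cons.comp hc (.const [])
  exact (Primrec.list_cons.comp hc' (h₁.comp .fst)).pair ((h₂.comp .fst).pair
    (Primrec.list_cons.comp ((Primrec.list_append.comp (Primrec.list_append.comp
      (hw.comp .fst) hc') (.const [Token.logic 0])).pair (.const true)) (h₃.comp .fst)))

theorem primrec_pushAtom {α : Type*} [Primcodable α] {w : α → List Token} {st : α → MState}
    (hw : Primrec w) (hst : Primrec st) : Primrec fun a => pushAtom (w a) (st a) := by
  have h₁ : Primrec fun a => (st a).1 := Primrec.fst.comp hst
  have h₂ : Primrec fun a => (st a).2.1 := Primrec.fst.comp (Primrec.snd.comp hst)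
  have h₃ : Primrec fun a => (st a).2.2 := Primrec.snd.comp (Primrec.snd.comp hst)
  refine Primrec.list_map (.const [true, false]) ?_
  exact (h₁.comp .fst).pair ((Primrec.list_cons.comp .snd (h₂.comp .fst)).pair
    (Primrec.list_cons.comp ((hw.comp .fst).pair .snd) (h₃.comp .fst)))

theorem primrec_logicMoves : Primrec₂ logicMoves := by
  have hst : Primrec fun q : MState × ℕ => q.1 := Primrec.fst
  have h₁ : Primrec fun q : MState × ℕ => q.1.1 := Primrec.fst.comp hst
  have h₂ : Primrec fun q : MState × ℕ => q.1.2.1 := Primrec.fst.comp (Primrec.snd.comp hst)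
  have h₃ : Primrec fun q : MState × ℕ => q.1.2.2 := Primrec.snd.comp (Primrec.snd.comp hst)
  have hp : Primrec fun q : MState × ℕ => popWords 2 q.1.1 := primrec_popWords (.const 2) h₁
  have hhd : Primrec fun q : MState × ℕ => q.1.2.1.headI := Primrec.list_headI.comp h₂
  have htl : Primrec fun q : MState × ℕ => q.1.2.1.tail := Primrec.list_tail.comp h₂
  have hhd' : Primrec fun q : MState × ℕ => q.1.2.1.tail.headI := Primrec.list_headI.comp htl
  have htl' : Primrec fun q : MState × ℕ => q.1.2.1.tail.tail := Primrec.list_tail.comp htl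
  have hret : ∀ {f : MState × ℕ → List Bool}, Primrec f →
      Primrec fun q : MState × ℕ => [((q.1.1, f q, q.1.2.2) : MState)] := fun hf =>
    Primrec.list_cons.comp (h₁.pair (hf.pair h₃)) (.const [])
  have heq : ∀ n : ℕ, PrimrecPred fun q : MState × ℕ => q.2 = n := fun n =>
    Primrec.eq.comp .snd (.const n)
  refine Primrec.ite (heq 0) (primrec_pushAtom (Primrec.list_append.comp (Primrec.fst.comp hp)
    (.const _)) ((Primrec.snd.comp hp).pair (Primrec.snd.comp hst))) ?_
  refine Primrec.ite (heq 1) (hret (Primrec.list_cons.comp (.const true) h₂)) ?_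
  refine Primrec.ite (heq 2) (hret (Primrec.list_cons.comp (Primrec.not.comp hhd) htl)) ?_
  exact Primrec.ite (heq 3) (hret (Primrec.list_cons.comp (Primrec.and.comp hhd' hhd) htl'))
    (hret (Primrec.list_cons.comp (Primrec.or.comp hhd' hhd) htl'))

theorem primrec_moves (S : ℕ) (C : List ℕ) : Primrec₂ (moves S C) := by
  have hdom : Primrec fun f : FunSym => (FunSym.dom f).length :=
    Primrec.list_length.comp (Primrec.fst.comp .snd)
  have hrdom : Primrec fun r : RelSym => (RelSym.dom r).length := Primrec.list_length.comp .snd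
  refine Primrec.sumCasesOn (f := fun q : MState × Token => q.2) Primrec.snd ?_ ?_
  · have hx : Primrec fun q : (MState × Token) × Var => q.2 := Primrec.snd
    exact primrec_pushTerm S C (Primrec.snd.comp hx)
      (Primrec.list_cons.comp (Primrec.sumInl.comp hx) (.const [])) (Primrec.fst.comp .fst)
  refine Primrec.sumCasesOn (f := fun q : (MState × Token) × (FunSym ⊕ RelSym ⊕ ℕ) => q.2)
    Primrec.snd ?_ ?_
  · have hst : Primrec fun q : ((MState × Token) × (FunSym ⊕ RelSym ⊕ ℕ)) × FunSym => q.1.1.1 :=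
      Primrec.fst.comp (Primrec.fst.comp .fst)
    have hp := primrec_popWords (hdom.comp (Primrec.snd
      (α := (MState × Token) × (FunSym ⊕ RelSym ⊕ ℕ)))) (Primrec.fst.comp hst)
    exact primrec_pushTerm S C (Primrec.snd.comp (Primrec.snd.comp .snd))
      (Primrec.list_append.comp (Primrec.fst.comp hp)
        (Primrec.list_cons.comp (primrec_token_fn.comp .snd) (.const [])))
      ((Primrec.snd.comp hp).pair (Primrec.snd.comp hst))
  refine Primrec.sumCasesOn (f := fun q : ((MState × Token) × (FunSym ⊕ RelSym ⊕ ℕ)) ×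
    (RelSym ⊕ ℕ) => q.2) Primrec.snd ?_ ?_
  · have hst : Primrec fun q : (((MState × Token) × (FunSym ⊕ RelSym ⊕ ℕ)) ×
        (RelSym ⊕ ℕ)) × RelSym => q.1.1.1.1 :=
      Primrec.fst.comp (Primrec.fst.comp (Primrec.fst.comp .fst))
    have hp := primrec_popWords (hrdom.comp (Primrec.snd
      (α := ((MState × Token) × (FunSym ⊕ RelSym ⊕ ℕ)) × (RelSym ⊕ ℕ)))) (Primrec.fst.comp hst)
    exact primrec_pushAtom
      (Primrec.list_append.comp (Primrec.fst.comp hp)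
        (Primrec.list_cons.comp (primrec_token_rel.comp .snd) (.const [])))
      ((Primrec.snd.comp hp).pair (Primrec.snd.comp hst))
  · exact primrec_logicMoves.comp (Primrec.fst.comp (Primrec.fst.comp (Primrec.fst.comp .fst)))
      Primrec.snd

theorem primrec_runWord (S : ℕ) (C : List ℕ) (sts : List MState) :
    Primrec fun w => runWord S C w sts := by
  refine Primrec.list_foldl (h := fun _ (q : List MState × Token) =>
    q.1.flatMap fun st => moves S C st q.2) .id (.const sts) ?_
  exact Primrec.list_flatMap (Primrec.fst.comp .snd)
    ((primrec_moves S C).comp .snd (Primrec.snd.comp (Primrec.snd.comp .fst)))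

open Classical in
/-- The token is over the signature `A`. -/
noncomputable def Token.isIn (A : Signature) (tok : Token) : Bool :=
  Sum.casesOn tok (fun x => decide (x.2 ∈ A.sorts)) fun tok =>
    Sum.casesOn tok (fun f => decide (f ∈ A.funs)) fun tok =>
    Sum.casesOn tok (fun r => decide (r ∈ A.rels)) fun _ => true

theorem computable_token_isIn {A : Signature} (hA : A.Effective) :
    Computable (Token.isIn A) := by
  classical
  obtain ⟨hs, hf, hr⟩ := hA
  refine Computable.sumCasesOn .id (hs.decide.comp (Computable.snd.comp .snd)) ?_
  refine Computable.sumCasesOn .snd (hf.decide.comp .snd) ?_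
  exact Computable.sumCasesOn .snd (hr.decide.comp .snd) (.const true)

theorem all_flatten_ofFn {β : Type*} {n : ℕ} {F : Fin n → List β} {p : β → Bool} :
    (List.ofFn F).flatten.all p = true ↔ ∀ i, (F i).all p = true := by
  simp only [List.all_eq_true, mem_flatten_ofFn]
  exact ⟨fun h i x hx => h x ⟨i, hx⟩, fun h x ⟨i, hx⟩ => h i x hx⟩

/-- Well-sortedness is built into terms, so being over a signature is a condition on single tokens.
This makes it computable on words for an effective signature. -/
theorem Term.all_code_isIn {A : Signature} {s : ℕ} (t : Term s) :
    t.code.all (Token.isIn A) = true ↔ t.In A := by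
  induction t with
  | var x => simp [Term.code, Term.In, Token.isIn]
  | app f ts ih =>
    rw [Term.code, Term.In, List.all_append, Bool.and_eq_true, all_flatten_ofFn, and_comm]
    exact and_congr (by simp [Token.isIn]) (forall_congr' ih)

theorem Atom.all_code_isIn {A : Signature} (α : Atom) :
    α.code.all (Token.isIn A) = true ↔ α.In A := by
  cases α with
  | equal t u =>
    rw [Atom.code, Atom.In, List.all_append, List.all_append, Bool.and_eq_true, Bool.and_eq_true,
      Term.all_code_isIn, Term.all_code_isIn]
    simp [Token.isIn]
  | rel r ts =>
    rw [Atom.code, Atom.In, List.all_append, Bool.and_eq_true, all_flatten_ofFn, and_comm]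
    exact and_congr (by simp [Token.isIn]) (forall_congr' fun i => (ts i).all_code_isIn)

/-- The words of the literals over the signature `A`. -/
noncomputable def wordsIn (A : Signature) (K : List (List Token × Bool)) :
    List (List Token × Bool) :=
  K.filter fun l => l.1.all (Token.isIn A)

open Classical in
theorem wordsIn_map_code {A : Signature} (Δ : List Literal) :
    wordsIn A (Δ.map Literal.code) = (Δ.filter fun l => l.1.In A).map Literal.code := by
  rw [wordsIn, List.filter_map]
  congr 2
  funext l
  rw [Bool.eq_iff_iff, decide_eq_true_eq]
  exact l.1.all_code_isIn

/-- Decide satisfiability in the union of two theories by means of solvers, on words. -/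
noncomputable def decideWord (sig : Side → Signature) (S : ℕ) (C : List ℕ)
    (g : Side → List (List Token × Bool) → Option (List (List Token × Bool)))
    (w : List Token) : Bool :=
  (runWord S C w [([], [], [])]).any fun st => st.2.1.headI &&
    ((g .wf (wordsIn (sig .wf) st.2.2)).isNone && (g .pm (wordsIn (sig .pm) st.2.2)).isNone)

theorem computable_decideWord {sig : Side → Signature} (S : ℕ) (C : List ℕ)
    {g : Side → List (List Token × Bool) → Option (List (List Token × Bool))}
    (hsig : ∀ L, (sig L).Effective) (hg : ∀ L, Computable (g L)) :
    Computable (decideWord sig S C g) := by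
  have hnone : Computable fun o : Option (List (List Token × Bool)) => o.isNone :=
    (Primrec.not.comp Primrec.option_isSome).to_comp.of_eq fun o => by cases o <;> rfl
  have hL : ∀ L, Computable fun st : MState => (g L (wordsIn (sig L) st.2.2)).isNone := fun L =>
    hnone.comp ((hg L).comp (computable_list_filter (Computable.snd.comp .snd)
      (computable_list_all .fst (computable_token_isIn (hsig L)))))
  exact computable_list_any (primrec_runWord S C _).to_comp (Primrec.and.to_comp.comp
    ((Primrec.list_headI.to_comp).comp (Computable.fst.comp .snd))
    (Primrec.and.to_comp.comp (hL .wf) (hL .pm)))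

open Classical in
theorem decideWord_code {sig : Side → Signature} {S : ℕ} {C : List ℕ} {solve : Side → Solver}
    {g : Side → List (List Token × Bool) → Option (List (List Token × Bool))}
    (hg : ∀ L (Γ : List Literal), (∀ l ∈ Γ, l.1.In (sig L)) →
      g L (Γ.map Literal.code) = (solve L Γ).map (List.map Literal.code)) (φ : QF) :
    decideWord sig S C g φ.code = true ↔ ∃ Δ, φ.Out S C true Δ ∧
      ∀ L, solve L (Δ.filter fun l => l.1.In (sig L)) = none := by
  have key : ∀ (Δ : List Literal) (L : Side),
      (g L (wordsIn (sig L) (Δ.map Literal.code))).isNone = true ↔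
        solve L (Δ.filter fun l => l.1.In (sig L)) = none := by
    intro Δ L
    -- `g` is specified only on words of literals over the signature, and the filter guarantees that
    -- they are such.
    rw [wordsIn_map_code, hg L _ fun l hl => by simpa using (List.mem_filter.1 hl).2]
    simp
  simp only [decideWord, List.any_eq_true, QF.mem_runWord, List.append_nil, Bool.and_eq_true]
  constructor
  · rintro ⟨_, ⟨b, Δ, h, rfl⟩, hb, h₁, h₂⟩
    obtain rfl : b = true := hb
    refine ⟨Δ, h, ?_⟩
    rintro (_ | _)
    · exact (key Δ _).1 h₁
    · exact (key Δ _).1 h₂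
  · rintro ⟨Δ, h, hs⟩
    exact ⟨_, ⟨true, Δ, h, rfl⟩, rfl, (key Δ _).2 (hs _), (key Δ _).2 (hs _)⟩

/-! ### The decision procedure -/

/-- The algorithm is a decision procedure, for any two theories that share an enumerated data-type
theory and nothing else. -/
theorem algorithmDecides {S : ℕ} {C : List ℕ} {sig : Side → Signature}
    (hsh : (sig .wf).inter (sig .pm) = edtSignature S C) (heff : ∀ L, (sig L).Effective)
    {T : Side → Set Formula} (hT : ∀ L, IsTheory (sig L) (T L)) (hE : ∀ L, EDT S C ⊆ T L)
    {solve : Side → Solver} (hsolve : ∀ L, (solve L).Decides (sig L) (T L)) :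
    AlgorithmDecides sig S C solve (wholeSig sig) (T .wf ∪ T .pm) := by
  classical
  have hsound : ∀ L, (solve L).Sound (sig L) (T L) := fun L => (hsolve L).unsat
  have hsat := fun L => (hsolve L).sat
  have hacc : ∀ φ : QF, Acc (fun d c => Step sig S C solve φ c d) (start sig φ) := fun φ =>
    acc_loop hsh hsound _ fun _ hα => Or.inl hα
  have hcorrect : ∀ φ : QF, φ.In (wholeSig sig) → ∀ b,
      Reaches sig S C solve φ (start sig φ) (.ret b) →
        (b = true ↔ SatQF (T .wf ∪ T .pm) φ) := by
    intro φ hφ b hb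
    have := Config.Valid.reaches hsh hT hE hsound hsat hφ hb
    rw [← satQF_purify_iff hφ]
    cases b with
    | true => exact ⟨fun _ => this, fun _ => rfl⟩
    | false => exact ⟨fun h => absurd h Bool.false_ne_true, fun h => absurd h this⟩
  refine ⟨fun φ _ => hacc φ, fun φ _ c _ => step_or_ret c, hcorrect, ?_⟩
  choose g hg hgs using fun L => (hsolve L).computable
  -- The computable function does not imitate a run. Some run ends with an answer `b`, and both `b`
  -- and `decideWord` express satisfiability, so they agree.
  refine ⟨decideWord sig S C g, computable_decideWord S C heff hg, fun φ hφ => ?_⟩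
  obtain ⟨b, hb⟩ := exists_reaches_ret (hacc φ)
  have h := (hcorrect φ hφ b hb).trans (satQF_iff_exists_out hsh hT hE hsound hsat hφ
    (fun L Δ => Δ.filter fun l => l.1.In (sig L)) (by simp))
  rw [← decideWord_code hgs φ, ← Bool.eq_iff_iff] at h
  rwa [← h]

end SOA

theorem mainTheorem7
    -- The substrate: a sort and finitely many constants.
    (S : ℕ) (C : List ℕ) (hC : C ≠ []) (hCnodup : C.Nodup)
    -- The signatures of the two levels, and the relational state variables of the second one.
    (sigWF sigPM : SOA.Signature) (P : Set SOA.RelSym)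
    (hP : ∀ r ∈ P, ∀ s ∈ SOA.RelSym.dom r, s ∈ sigPM.sorts)
    (hPfresh : Disjoint P (sigWF.union sigPM).rels)
    (hShared : sigWF.inter sigPM = SOA.edtSignature S C)
    (hWFeff : sigWF.Effective) (hPMeff : (sigPM.withPreds P hP).Effective)
    -- The theories.
    (TWF TPM : Set SOA.Formula)
    (hTWF : SOA.IsTheory sigWF TWF) (hTPM : SOA.IsTheory (sigPM.withPreds P hP) TPM)
    (hSubWF : SOA.EDT S C ⊆ TWF) (hSubPM : SOA.EDT S C ⊆ TPM)
    (hConsWF : SOA.Consistent TWF) (hConsPM : SOA.Consistent TPM)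
    -- The theory solvers.
    (solveWF solvePM : SOA.Solver)
    (hSolveWF : solveWF.Decides sigWF TWF)
    (hSolvePM : solvePM.Decides (sigPM.withPreds P hP) TPM) :
    SOA.AlgorithmDecides (SOA.levels sigWF (sigPM.withPreds P hP)) S C
      (SOA.solvers solveWF solvePM) (sigWF.union (sigPM.withPreds P hP)) (TWF ∪ TPM) := by
  have hsh : sigWF.inter (sigPM.withPreds P hP) = SOA.edtSignature S C := by
    -- The state variables are not symbols of the first level, so adding them to the second leaves
    -- the intersection unchanged.
    refine Eq.trans (b := sigWF.inter sigPM) (SOA.Signature.ext rfl rfl ?_) hShared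
    refine Set.ext fun r => ⟨fun h => ⟨h.1, h.2.resolve_right fun hr => ?_⟩,
      fun h => ⟨h.1, Or.inl h.2⟩⟩
    exact Set.disjoint_left.1 hPfresh hr (Or.inl h.1)
  exact SOA.algorithmDecides (sig := SOA.levels sigWF (sigPM.withPreds P hP))
    (T := fun | .wf => TWF | .pm => TPM) (solve := SOA.solvers solveWF solvePM) hsh
    (fun | .wf => hWFeff | .pm => hPMeff) (fun | .wf => hTWF | .pm => hTPM)
    (fun | .wf => hSubWF | .pm => hSubPM) (fun | .wf => hSolveWF | .pm => hSolvePM)
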